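/- All algebras are finite-dimensional over $\mathbb{C}$; omitted products of basis elements are zero. A (right) Leibniz algebra is a vector space with a bilinear bracket satisfying $[x,[y,z]]=[[x,y],z]-[[x,z],y]$; its nilradical is its maximal nilpotent two-sided ideal. Let $k\ge 1$ and $n-(2k+1)\ge 4$, and let $\mu_3$ be the $n$-dimensional Leibniz algebra with basis $e_1,\dots,e_{n-2k},f_1,\dots,f_{2k}$ and products \[ [e_1,e_1]=e_3,\quad [e_i,e_1]=e_{i+1}\ (2\le i\le n-2k-1),\quad [e_1,f_j]=[e_2,f_j]=f_{k+j}\ (1\le j\le k). \] **Theorem.** Let $R$ be a solvable Leibniz algebra with nilradical $N\cong\mu_3$, $N$ having a basis $e_1,\dots,e_{n-2k},f_1,\dots,f_{2k}$ with the above table, and let $R=N\oplus\langle x\rangle$ with $x\ne 0$. Let $\mathcal{F}=\langle f_1,\dots,f_k\rangle$, let $\mathcal{R}_x(y)=[y,x]$, and let $\varepsilon$ be the projection of $N$ onto $\mathcal{F}$ that kills the other basis elements. Assume that in some basis of $\mathcal{F}$ the operator $\varepsilon\circ\mathcal{R}_{x}|_{\mathcal{F}}$ is a single Jordan block $J_\lambda$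 with $\lambda\neq 0$ (that is, $g_i\mapsto\lambda g_i+g_{i+1}$ for $1\le i\le k-1$ and $g_k\mapsto\lambda g_k$). Then $R$ admits a basis $e_1,\dots,e_{n-2k},f_1,\dots,f_{2k},x$ (new elements, denoted by the same letters) in which its multiplication table is \[ \begin{array}{ll} [e_i,e_1]=e_{i+1}, & 2\le i\le n-2k-1,\\ [e_2,f_i]=f_{k+i}, & 1\le i\le k,\\ [e_1,x]=a_1e_1+a_{n-2k}e_{n-2k}+b_1f_1+b_2f_{k+1},\\ [e_2,x]=(a_1+a_2)e_2+\sum_{i=4}^{n-2k-1}a_ie_i+\beta e_{n-2k},\\ [e_3,x]=(2a_1+a_2)e_3+\sum_{i=5}^{n-2k}a_{i-1}e_i+b_1f_{k+1},\\ [e_i,x]=((i-1)a_1+a_2)e_i+\sum_{j=i+2}^{n-2k}a_{j-i+2}e_j, & 4\le i\le n-2k,\\ [f_i,x]=-[x,f_i]=f_i+f_{i+1}, & 1\le i\le k-1,\\ [f_k,x]=-[x,f_k]=f_k,\\ [f_{k+i},x]=(a_1+a_2+1)f_{k+i}+f_{k+i+1}, & 1\le i\le k-1,\\ [f_{2k},x]=(a_1+a_2+1)f_{2k},\\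 [x,e_1]=-a_1e_1-b_1f_1+\sum_{i=1}^{k}\theta_{n-k+i}f_{k+i},\\ [x,e_2]=\gamma e_{n-2k},\\ [x,x]=\delta_1e_{n-2k-1}+\delta_2e_{n-2k}+\delta_3f_{k+1} \end{array} \] for some complex parameters $a_i$ ($1\le i\le n-2k$, $i\ne 3$), $b_1,b_2,\beta,\gamma,\delta_1,\delta_2,\delta_3$, $\theta_{n-k+j}$ ($1\le j\le k$) satisfying \[ \begin{array}{ll} (a_1+a_2)\gamma=0, & (n-2k-2)a_1\gamma=0,\\ \delta_1=-a_1a_{n-2k}, & a_1b_2=(-1)^{k-1}(a_2+1)^k\theta_n,\\ \theta_{n-i}=(-1)^i(a_2+1)^i\theta_n, & 0\le i\le k-1. \end{array} \] -/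

import Mathlib

/-! Right Leibniz algebras over `ℂ`.  An algebra on a complex vector space `L` is given by its
bilinear bracket `br : L →ₗ[ℂ] L →ₗ[ℂ] L`, where `br x y` is `[x, y]`. -/

namespace Leib

section Basic

variable {L : Type*} [AddCommGroup L] [Module ℂ L]

/-- The (right) Leibniz identity `[x,[y,z]] = [[x,y],z] - [[x,z],y]`. -/
def IsLeibniz (br : L →ₗ[ℂ] L →ₗ[ℂ] L) : Prop :=
  ∀ x y z : L, br x (br y z) = br (br x y) z - br (br x z) y

/-- Two-sided ideals. -/
def IsIdeal (br : L →ₗ[ℂ] L →ₗ[ℂ] L) (I : Submodule ℂ L) : Prop :=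
  ∀ y ∈ I, ∀ z : L, br y z ∈ I ∧ br z y ∈ I

/-- The lower central series of `I` (as an algebra in its own right), numbered from `0`:
`I, [I,I], [[I,I],I], …`.  Here `Submodule.map₂ br A B` is the span of all `[a, b]`. -/
def lowerCentral (br : L →ₗ[ℂ] L →ₗ[ℂ] L) (I : Submodule ℂ L) : ℕ → Submodule ℂ L
  | 0 => I
  | s + 1 => Submodule.map₂ br (lowerCentral br I s) I

/-- Nilpotency of `I` as an algebra. -/
def IsNilpotentSub (br : L →ₗ[ℂ] L →ₗ[ℂ] L) (I : Submodule ℂ L) : Prop :=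
  ∃ s : ℕ, lowerCentral br I s = ⊥

/-- The derived series of the whole algebra, numbered from `0`. -/
def derivedSeries (br : L →ₗ[ℂ] L →ₗ[ℂ] L) : ℕ → Submodule ℂ L
  | 0 => ⊤
  | s + 1 => Submodule.map₂ br (derivedSeries br s) (derivedSeries br s)

/-- Solvability of the whole algebra. -/
def IsSolvableAlg (br : L →ₗ[ℂ] L →ₗ[ℂ] L) : Prop :=
  ∃ s : ℕ, derivedSeries br s = ⊥

/-- `N` is the nilradical: the maximal nilpotent ideal. -/
def IsNilradical (br : L →ₗ[ℂ] L →ₗ[ℂ] L) (N : Submodule ℂ L) : Prop :=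
  Maximal (fun I : Submodule ℂ L => IsIdeal br I ∧ IsNilpotentSub br I) N

theorem IsNilradical.isIdeal {br : L →ₗ[ℂ] L →ₗ[ℂ] L} {N : Submodule ℂ L}
    (hN : IsNilradical br N) : IsIdeal br N := hN.1.1

/-- The restriction to an ideal `N` of the right multiplication operator `y ↦ [y, x]`. -/
def rightMulOn {br : L →ₗ[ℂ] L →ₗ[ℂ] L} {N : Submodule ℂ L} (hN : IsIdeal br N) (x : L) :
    N →ₗ[ℂ] N :=
  (br.flip x).restrict (fun y hy => (hN y hy x).1)

end Basic

section Mu3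

variable {L : Type*} [AddCommGroup L] [Module ℂ L]

/-- Index type of a basis `e_1, …, e_{n-2k}, f_1, …, f_{2k}`. -/
abbrev NilIdx (n k : ℕ) : Type := Fin (n - 2 * k) ⊕ Fin (2 * k)

/-- `e_i` of a family `e_1, …, e_{n-2k}, f_1, …, f_{2k}` (indices start at `1`; the value is `0`
outside `1 ≤ i ≤ n - 2k`, where it is never used). -/
def eVec {n k : ℕ} (v : NilIdx n k → L) (i : ℕ) : L :=
  if h : 1 ≤ i ∧ i ≤ n - 2 * k then v (Sum.inl ⟨i - 1, by omega⟩) else 0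

/-- `f_i` of a family `e_1, …, e_{n-2k}, f_1, …, f_{2k}` (indices start at `1`; the value is `0`
outside `1 ≤ i ≤ 2k`, where it is never used). -/
def fVec {n k : ℕ} (v : NilIdx n k → L) (i : ℕ) : L :=
  if h : 1 ≤ i ∧ i ≤ 2 * k then v (Sum.inr ⟨i - 1, by omega⟩) else 0

/-- The multiplication table of `μ₃` in the basis `e_1, …, e_{n-2k}, f_1, …, f_{2k}`; the last
fields say that all other products of basis elements vanish. -/
structure IsMu3Table (br : L →ₗ[ℂ] L →ₗ[ℂ] L) {n k : ℕ} (v : NilIdx n k → L) : Prop where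
  e1_e1 : br (eVec v 1) (eVec v 1) = eVec v 3
  ei_e1 : ∀ i, 2 ≤ i → i ≤ n - 2 * k - 1 → br (eVec v i) (eVec v 1) = eVec v (i + 1)
  e1_fj : ∀ j, 1 ≤ j → j ≤ k → br (eVec v 1) (fVec v j) = fVec v (k + j)
  e2_fj : ∀ j, 1 ≤ j → j ≤ k → br (eVec v 2) (fVec v j) = fVec v (k + j)
  elast_e1 : br (eVec v (n - 2 * k)) (eVec v 1) = 0
  ei_ej : ∀ i j, 1 ≤ i → i ≤ n - 2 * k → 2 ≤ j → j ≤ n - 2 * k →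
    br (eVec v i) (eVec v j) = 0
  ei_fj : ∀ i j, 3 ≤ i → i ≤ n - 2 * k → 1 ≤ j → j ≤ 2 * k →
    br (eVec v i) (fVec v j) = 0
  e12_fj : ∀ i j, 1 ≤ i → i ≤ 2 → k + 1 ≤ j → j ≤ 2 * k →
    br (eVec v i) (fVec v j) = 0
  fi_ej : ∀ i j, 1 ≤ i → i ≤ 2 * k → 1 ≤ j → j ≤ n - 2 * k →
    br (fVec v i) (eVec v j) = 0
  fi_fj : ∀ i j, 1 ≤ i → i ≤ 2 * k → 1 ≤ j → j ≤ 2 * k →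
    br (fVec v i) (fVec v j) = 0

/-- The position of `f_1, …, f_k` among the basis elements (numbered from `0`). -/
def fIdx (n k : ℕ) (j : Fin k) : NilIdx n k := Sum.inr (Fin.castLE (by omega) j)

/-- The space `𝓕` spanned by `f_1, …, f_k`. -/
def FSpace {N : Type*} [AddCommGroup N] [Module ℂ N] {n k : ℕ}
    (b : Module.Basis (NilIdx n k) ℂ N) : Submodule ℂ N :=
  Submodule.span ℂ (Set.range fun j : Fin k => b (fIdx n k j))

/-- The projection of `N` onto `𝓕` that kills the other basis elements. -/
noncomputable def projF {N : Type*} [AddCommGroup N] [Module ℂ N] {n k : ℕ}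
    (b : Module.Basis (NilIdx n k) ℂ N) : N →ₗ[ℂ] FSpace b :=
  LinearMap.codRestrict (FSpace b)
    (∑ j : Fin k, (b.coord (fIdx n k j)).smulRight (b (fIdx n k j)))
    (by
      intro y
      rw [LinearMap.sum_apply]
      refine Submodule.sum_mem _ fun j _ => ?_
      exact Submodule.smul_mem _ _ (Submodule.subset_span ⟨j, rfl⟩))

/-- The projection to `𝓕` of the restriction of `T` to `𝓕`, an operator on `𝓕`. -/
noncomputable def compressF {N : Type*} [AddCommGroup N] [Module ℂ N] {n k : ℕ}
    (b : Module.Basis (NilIdx n k) ℂ N) (T : N →ₗ[ℂ] N) : FSpace b →ₗ[ℂ] FSpace b :=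
  (projF b ∘ₗ T).domRestrict (FSpace b)

/-- The operator `S` is a single Jordan block `J_lam` of size `k` in some basis `g_1, …, g_k`:
`S g_i = lam g_i + g_{i+1}` for `i < k` and `S g_k = lam g_k`. -/
def IsJordanBlock {V : Type*} [AddCommGroup V] [Module ℂ V] (k : ℕ) (S : V →ₗ[ℂ] V)
    (lam : ℂ) : Prop :=
  ∃ g : Module.Basis (Fin k) ℂ V,
    ∀ i : Fin k, S (g i) = lam • g i + if h : (i : ℕ) + 1 < k then g ⟨i + 1, h⟩ else 0

/-- The parameters of the family `R(μ₃,1)(I)`: `a i` is used for `1 ≤ i ≤ n - 2k`, `i ≠ 3`, and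
`θ j` for `n - k + 1 ≤ j ≤ n`. -/
structure Params where
  a : ℕ → ℂ
  b₁ : ℂ
  b₂ : ℂ
  β : ℂ
  γ : ℂ
  δ₁ : ℂ
  δ₂ : ℂ
  δ₃ : ℂ
  θ : ℕ → ℂ

/-- The relations between the parameters. -/
structure Params.Relations (P : Params) (n k : ℕ) : Prop where
  gamma₁ : (P.a 1 + P.a 2) * P.γ = 0
  gamma₂ : ((n : ℂ) - 2 * k - 2) * P.a 1 * P.γ = 0
  delta₁ : P.δ₁ = -(P.a 1 * P.a (n - 2 * k))
  b_two : P.a 1 * P.b₂ = (-1) ^ (k - 1) * (P.a 2 + 1) ^ k * P.θ n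
  theta : ∀ i, i ≤ k - 1 → P.θ (n - i) = (-1) ^ i * (P.a 2 + 1) ^ i * P.θ n

open Finset in
/-- The multiplication table of `R(μ₃,1)(I)` in the basis
`e_1, …, e_{n-2k}, f_1, …, f_{2k}, x`, where `v` lists the `e`'s and `f`'s.  The fields after
`x_x` say that all products that are not listed before vanish. -/
structure IsRMu3Table (br : L →ₗ[ℂ] L →ₗ[ℂ] L) {n k : ℕ} (v : NilIdx n k → L) (x : L)
    (P : Params) : Prop where
  ei_e1 : ∀ i, 2 ≤ i → i ≤ n - 2 * k - 1 → br (eVec v i) (eVec v 1) = eVec v (i + 1)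
  e2_fi : ∀ i, 1 ≤ i → i ≤ k → br (eVec v 2) (fVec v i) = fVec v (k + i)
  e1_x : br (eVec v 1) x = P.a 1 • eVec v 1 + P.a (n - 2 * k) • eVec v (n - 2 * k)
    + P.b₁ • fVec v 1 + P.b₂ • fVec v (k + 1)
  e2_x : br (eVec v 2) x = (P.a 1 + P.a 2) • eVec v 2
    + ∑ i ∈ Icc 4 (n - 2 * k - 1), P.a i • eVec v i + P.β • eVec v (n - 2 * k)
  e3_x : br (eVec v 3) x = (2 * P.a 1 + P.a 2) • eVec v 3
    + ∑ i ∈ Icc 5 (n - 2 * k), P.a (i - 1) • eVec v i + P.b₁ • fVec v (k + 1)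
  ei_x : ∀ i, 4 ≤ i → i ≤ n - 2 * k →
    br (eVec v i) x = (((i : ℂ) - 1) * P.a 1 + P.a 2) • eVec v i
      + ∑ j ∈ Icc (i + 2) (n - 2 * k), P.a (j - i + 2) • eVec v j
  fi_x : ∀ i, 1 ≤ i → i ≤ k - 1 → br (fVec v i) x = fVec v i + fVec v (i + 1)
  x_fi : ∀ i, 1 ≤ i → i ≤ k - 1 → br x (fVec v i) = -(fVec v i + fVec v (i + 1))
  fk_x : br (fVec v k) x = fVec v k
  x_fk : br x (fVec v k) = -fVec v k
  fki_x : ∀ i, 1 ≤ i → i ≤ k - 1 →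
    br (fVec v (k + i)) x = (P.a 1 + P.a 2 + 1) • fVec v (k + i) + fVec v (k + i + 1)
  f2k_x : br (fVec v (2 * k)) x = (P.a 1 + P.a 2 + 1) • fVec v (2 * k)
  x_e1 : br x (eVec v 1) = -(P.a 1 • eVec v 1) - P.b₁ • fVec v 1
    + ∑ i ∈ Icc 1 k, P.θ (n - k + i) • fVec v (k + i)
  x_e2 : br x (eVec v 2) = P.γ • eVec v (n - 2 * k)
  x_x : br x x = P.δ₁ • eVec v (n - 2 * k - 1) + P.δ₂ • eVec v (n - 2 * k)
    + P.δ₃ • fVec v (k + 1)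
  e1_e1 : br (eVec v 1) (eVec v 1) = 0
  elast_e1 : br (eVec v (n - 2 * k)) (eVec v 1) = 0
  ei_ej : ∀ i j, 1 ≤ i → i ≤ n - 2 * k → 2 ≤ j → j ≤ n - 2 * k →
    br (eVec v i) (eVec v j) = 0
  ei_fj : ∀ i j, 1 ≤ i → i ≤ n - 2 * k → i ≠ 2 → 1 ≤ j → j ≤ 2 * k →
    br (eVec v i) (fVec v j) = 0
  e2_fkj : ∀ j, k + 1 ≤ j → j ≤ 2 * k → br (eVec v 2) (fVec v j) = 0
  fi_ej : ∀ i j, 1 ≤ i → i ≤ 2 * k → 1 ≤ j → j ≤ n - 2 * k →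
    br (fVec v i) (eVec v j) = 0
  fi_fj : ∀ i j, 1 ≤ i → i ≤ 2 * k → 1 ≤ j → j ≤ 2 * k →
    br (fVec v i) (fVec v j) = 0
  x_ei : ∀ i, 3 ≤ i → i ≤ n - 2 * k → br x (eVec v i) = 0
  x_fki : ∀ i, k + 1 ≤ i → i ≤ 2 * k → br x (fVec v i) = 0

end Mu3

end Leib

/-! The Leibniz identity makes `[·, x]` a derivation of `N` and forces `[y, [x, z]] = -[y, [z, x]]`,
`[y, [x, x]] = 0`. Replacing `e_1` by `e_1 - e_2` gives a vector that annihilates `N` from the left,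
so `N` becomes a chain `E 0, …, E M` under right multiplication by this vector, together with two
copies `φ V`, `ψ V` of `V = 𝓕` linked by `[E 0, φ v] = ψ v`. Left multiplication by `E 0` reads off
the `e₁`- and `φ`-coordinates, and right multiplication by `e₁` shifts chain coordinates; testing
the Leibniz identity against these two operators determines the action of `x` up to a few scalars
and vectors of `V`.

After division of `x` by `lam`, `x` induces on `V` an invertible operator `A`, a Jordan block of
eigenvalue `1`. Subtracting an element of `N` from `x` removes one coefficient of `[E 0, x]` and the
chain part of `[x, e₁] + φ' p` (`Frame.exists_adjust`). Here `φ' v = -[x, φ (A⁻¹ v)]` is the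
corrected copy of `V`, on which left and right multiplication by `x` are opposite
(`Frame.exists_normalForm`).

The remaining vectors of `V` are changed by the images of `c + A` for suitable scalars `c`. As `A`
is a single Jordan block, modulo such an image every vector is a multiple of the cyclic vector `G 0`
(`exists_add_eq_smul_of_shift`); hence the single parameters `b₁`, `b₂`, `δ₃`. The vector `θ`
satisfies `a_2 θ + A θ = a_1 b₂ G 0`, whose coordinates are the stated recursion (`coord_of_shift`).
-/

namespace Leib

open Finset

/-! ### Adapted presentation of `μ₃` and its coordinates -/

section Frame

variable {L V : Type*} [AddCommGroup L] [Module ℂ L] [AddCommGroup V] [Module ℂ V]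

/-- A presentation of the ideal `N ≅ μ₃` adapted to derivations: `e₁` is left annihilating,
`E 0, …, E M` is the chain `E i = [E (i - 1), e₁]`, and `ψ v = [E 0, φ v]`.  The functionals
`κ₁`, `κ`, `π`, `ρ` read off the coordinates. -/
structure Frame (br : L →ₗ[ℂ] L →ₗ[ℂ] L) (N : Submodule ℂ L) (M : ℕ) (V : Type*)
    [AddCommGroup V] [Module ℂ V] where
  e₁ : L
  E : ℕ → L
  φ : V →ₗ[ℂ] L
  ψ : V →ₗ[ℂ] L
  κ₁ : L →ₗ[ℂ] ℂ
  κ : ℕ → L →ₗ[ℂ] ℂ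
  π : L →ₗ[ℂ] V
  ρ : L →ₗ[ℂ] V
  e₁_mem : e₁ ∈ N
  E_mem : ∀ i, E i ∈ N
  φ_mem : ∀ v, φ v ∈ N
  ψ_mem : ∀ v, ψ v ∈ N
  E_of_lt : ∀ i, M < i → E i = 0
  decomp : ∀ y ∈ N, y = κ₁ y • e₁ + ∑ i ∈ range (M + 1), κ i y • E i + φ (π y) + ψ (ρ y)
  κ₁_e₁ : κ₁ e₁ = 1
  κ₁_E : ∀ i, κ₁ (E i) = 0
  κ₁_φ : ∀ v, κ₁ (φ v) = 0
  κ₁_ψ : ∀ v, κ₁ (ψ v) = 0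
  κ_e₁ : ∀ j, κ j e₁ = 0
  κ_E : ∀ i j, i ≤ M → κ j (E i) = if i = j then 1 else 0
  κ_φ : ∀ j v, κ j (φ v) = 0
  κ_ψ : ∀ j v, κ j (ψ v) = 0
  π_e₁ : π e₁ = 0
  π_E : ∀ i, π (E i) = 0
  π_φ : ∀ v, π (φ v) = v
  π_ψ : ∀ v, π (ψ v) = 0
  ρ_e₁ : ρ e₁ = 0
  ρ_E : ∀ i, ρ (E i) = 0
  ρ_φ : ∀ v, ρ (φ v) = 0
  ρ_ψ : ∀ v, ρ (ψ v) = v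
  e₁_left : ∀ y ∈ N, br e₁ y = 0
  φ_left : ∀ v, ∀ y ∈ N, br (φ v) y = 0
  ψ_left : ∀ v, ∀ y ∈ N, br (ψ v) y = 0
  E_right : ∀ i, ∀ y ∈ N, br y (E i) = 0
  ψ_right : ∀ v, ∀ y ∈ N, br y (ψ v) = 0
  E_e₁ : ∀ i, br (E i) e₁ = E (i + 1)
  E_zero_φ : ∀ v, br (E 0) (φ v) = ψ v
  E_succ_φ : ∀ i v, br (E (i + 1)) (φ v) = 0

attribute [simp] Frame.e₁_mem Frame.E_mem Frame.φ_mem Frame.ψ_mem Frame.κ₁_e₁ Frame.κ₁_E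
  Frame.κ₁_φ Frame.κ₁_ψ Frame.κ_e₁ Frame.κ_φ Frame.κ_ψ Frame.π_e₁ Frame.π_E Frame.π_φ Frame.π_ψ
  Frame.ρ_e₁ Frame.ρ_E Frame.ρ_φ Frame.ρ_ψ Frame.E_e₁ Frame.E_zero_φ Frame.E_succ_φ

namespace Frame

variable {br : L →ₗ[ℂ] L →ₗ[ℂ] L} {N : Submodule ℂ L} {M : ℕ} (F : Frame br N M V)

theorem br_e₁ {y : L} (hy : y ∈ N) :
    br y F.e₁ = ∑ i ∈ range (M + 1), F.κ i y • F.E (i + 1) := by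
  conv_lhs => rw [F.decomp y hy]
  simp [F.e₁_left, F.φ_left, F.ψ_left, LinearMap.sum_apply]

theorem br_φ {y : L} (hy : y ∈ N) (v : V) : br y (F.φ v) = F.κ 0 y • F.ψ v := by
  conv_lhs => rw [F.decomp y hy]
  simp [F.e₁_left, F.φ_left, F.ψ_left, LinearMap.sum_apply, sum_range_succ']

/-- The main test operator: bracketing with `E 0` detects exactly the coordinates `κ₁` and `π`. -/
theorem E_zero_br {y : L} (hy : y ∈ N) : br (F.E 0) y = F.κ₁ y • F.E 1 + F.ψ (F.π y) := by
  conv_lhs => rw [F.decomp y hy]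
  simp [F.E_right, F.ψ_right]

theorem E_succ_br (i : ℕ) {y : L} (hy : y ∈ N) :
    br (F.E (i + 1)) y = F.κ₁ y • F.E (i + 2) := by
  conv_lhs => rw [F.decomp y hy]
  simp [F.E_right, F.ψ_right]

theorem κ_sum (a : ℕ → ℂ) (j : ℕ) (hj : j ≤ M) :
    F.κ j (∑ i ∈ range (M + 1), a i • F.E i) = a j := by
  rw [map_sum, sum_eq_single j]
  · simp [F.κ_E j j hj]
  · intro i hi hij
    rw [map_smul, F.κ_E i j (by simpa [Nat.lt_succ_iff] using hi), if_neg hij, smul_zero]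
  · intro h; exact absurd (mem_range.2 (by omega)) h

theorem κ_sum_shift (a : ℕ → ℂ) (j : ℕ) (hj : j + 1 ≤ M) :
    F.κ (j + 1) (∑ i ∈ range (M + 1), a i • F.E (i + 1)) = a j := by
  rw [map_sum, sum_eq_single j]
  · simp [F.κ_E _ _ hj]
  · intro i hi hij
    by_cases h : i + 1 ≤ M
    · rw [map_smul, F.κ_E _ _ h, if_neg (by omega), smul_zero]
    · rw [F.E_of_lt _ (by omega), smul_zero, map_zero]
  · intro h; exact absurd (mem_range.2 (by omega)) h

theorem κ_zero_E_succ (i : ℕ) : F.κ 0 (F.E (i + 1)) = 0 := by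
  by_cases h : i + 1 ≤ M
  · rw [F.κ_E _ _ h, if_neg (by omega)]
  · rw [F.E_of_lt _ (by omega), map_zero]

theorem κ_succ_br_e₁ {y : L} (hy : y ∈ N) (j : ℕ) (hj : j + 1 ≤ M) :
    F.κ (j + 1) (br y F.e₁) = F.κ j y := by
  rw [F.br_e₁ hy, F.κ_sum_shift _ j hj]

theorem κ_zero_br_e₁ {y : L} (hy : y ∈ N) : F.κ 0 (br y F.e₁) = 0 := by
  rw [F.br_e₁ hy, map_sum]
  exact sum_eq_zero fun i _ => by rw [map_smul, κ_zero_E_succ, smul_zero]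

theorem ρ_br_e₁ {y : L} (hy : y ∈ N) : F.ρ (br y F.e₁) = 0 := by
  simp [F.br_e₁ hy]

/-- The centralizer of `e₁` in `N`. -/
theorem eq_of_br_e₁_eq_zero {y : L} (hy : y ∈ N) (h : br y F.e₁ = 0) :
    y = F.κ₁ y • F.e₁ + F.κ M y • F.E M + F.φ (F.π y) + F.ψ (F.ρ y) := by
  conv_lhs => rw [F.decomp y hy]
  rw [sum_range_succ, sum_eq_zero, zero_add]
  intro i hi
  rw [← F.κ_succ_br_e₁ hy i (by simpa using hi), h, map_zero, zero_smul]

end Frame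

end Frame

/-! ### Two forms of the Leibniz identity -/

section Leibniz

variable {L : Type*} [AddCommGroup L] [Module ℂ L] {br : L →ₗ[ℂ] L →ₗ[ℂ] L}

theorem IsLeibniz.derivation (hL : IsLeibniz br) (y z x : L) :
    br (br y z) x = br (br y x) z + br y (br z x) := by
  rw [hL y z x]; abel

/-- The right side of the Leibniz identity is antisymmetric in its last two arguments, so `[x, z] +
[z, x]` is annihilated by every left multiplication. -/
theorem IsLeibniz.br_swap (hL : IsLeibniz br) (y z x : L) :
    br y (br x z) = -br y (br z x) := by
  rw [hL y z x, hL y x z]; abel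

end Leibniz

/-! ### The action of `x` on `N` forced by the Leibniz identity -/

section Frame

variable {L V : Type*} [AddCommGroup L] [Module ℂ L] [AddCommGroup V] [Module ℂ V]
  {br : L →ₗ[ℂ] L →ₗ[ℂ] L} {N : Submodule ℂ L} {M : ℕ}

namespace Frame

/-! ### Right multiplication by `x` on `N` -/

theorem br_br_x_e₁_eq_zero (F : Frame br N M V) (hL : IsLeibniz br) (hN : IsIdeal br N) (x : L)
    {y : L} (hy : ∀ z ∈ N, br y z = 0) : br (br y x) F.e₁ = 0 := by
  have := hL.derivation y F.e₁ x
  rw [hy _ F.e₁_mem, hy _ (hN _ F.e₁_mem x).1] at this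
  simpa using this.symm

theorem e₁_x (F : Frame br N M V) (hL : IsLeibniz br) (hN : IsIdeal br N) (x : L) :
    br F.e₁ x = F.κ₁ (br F.e₁ x) • F.e₁ + F.κ M (br F.e₁ x) • F.E M
      + F.φ (F.π (br F.e₁ x)) + F.ψ (F.ρ (br F.e₁ x)) :=
  F.eq_of_br_e₁_eq_zero (hN _ F.e₁_mem x).1
    (F.br_br_x_e₁_eq_zero hL hN x fun z hz => F.e₁_left z hz)

theorem κ_e₁_x (F : Frame br N M V) (hL : IsLeibniz br) (hN : IsIdeal br N) (x : L) {i : ℕ}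
    (hi : i < M) : F.κ i (br F.e₁ x) = 0 := by
  rw [F.e₁_x hL hN x]
  simp [F.κ_E M i le_rfl, hi.ne']

/-- Differentiating `[E 1, φ v] = 0` produces `κ₁ [φ v, x]` as the coefficient of `E 2`, which is
nonzero as the chain is long enough; the other term is a multiple of `ψ v`. -/
theorem κ₁_φ_x (F : Frame br N M V) (hL : IsLeibniz br) (hN : IsIdeal br N) (hM : 3 ≤ M)
    (x : L) (v : V) : F.κ₁ (br (F.φ v) x) = 0 := by
  have h := hL.derivation (F.E 1) (F.φ v) x
  rw [F.E_succ_φ, F.br_φ (hN _ (F.E_mem 1) x).1, F.E_succ_br 0 (hN _ (F.φ_mem v) x).1] at h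
  simpa [F.κ_E 2 2 (by omega)] using (congrArg (F.κ 2) h).symm

theorem φ_x (F : Frame br N M V) (hL : IsLeibniz br) (hN : IsIdeal br N) (hM : 3 ≤ M)
    (x : L) (v : V) : br (F.φ v) x = F.κ M (br (F.φ v) x) • F.E M
      + F.φ (F.π (br (F.φ v) x)) + F.ψ (F.ρ (br (F.φ v) x)) := by
  conv_lhs => rw [F.eq_of_br_e₁_eq_zero (hN _ (F.φ_mem v) x).1
    (F.br_br_x_e₁_eq_zero hL hN x fun z hz => F.φ_left v z hz), F.κ₁_φ_x hL hN hM, zero_smul,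
    zero_add]

/-- Differentiate `[E 0, E 0] = 0`; the next two results are its `E 1`- and `ψ`-components. -/
theorem E_zero_br_E_zero_x (F : Frame br N M V) (hL : IsLeibniz br) (hN : IsIdeal br N) (x : L) :
    F.κ₁ (br (F.E 0) x) • F.E 1 + F.ψ (F.π (br (F.E 0) x)) = 0 := by
  have h := hL.derivation (F.E 0) (F.E 0) x
  have hy := (hN _ (F.E_mem 0) x).1
  rw [F.E_right 0 _ (F.E_mem 0), F.E_right 0 _ hy, F.E_zero_br hy] at h
  simpa using h.symm

theorem κ₁_E_zero_x (F : Frame br N M V) (hL : IsLeibniz br) (hN : IsIdeal br N) (hM : 3 ≤ M)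
    (x : L) : F.κ₁ (br (F.E 0) x) = 0 := by
  simpa [F.κ_E 1 1 (by omega)] using congrArg (F.κ 1) (F.E_zero_br_E_zero_x hL hN x)

theorem π_E_zero_x (F : Frame br N M V) (hL : IsLeibniz br) (hN : IsIdeal br N)
    (x : L) : F.π (br (F.E 0) x) = 0 := by
  simpa using congrArg F.ρ (F.E_zero_br_E_zero_x hL hN x)

theorem E_zero_x (F : Frame br N M V) (hL : IsLeibniz br) (hN : IsIdeal br N) (hM : 3 ≤ M)
    (x : L) : br (F.E 0) x = ∑ j ∈ range (M + 1), F.κ j (br (F.E 0) x) • F.E j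
      + F.ψ (F.ρ (br (F.E 0) x)) := by
  conv_lhs => rw [F.decomp _ (hN _ (F.E_mem 0) x).1, F.κ₁_E_zero_x hL hN hM, F.π_E_zero_x hL hN]
  simp

/-- Differentiate `E (i + 1) = [E i, e₁]` repeatedly. Each step shifts the chain and adds one `κ₁
[e₁, x]` to the diagonal; only the first, through `[E 0, [e₁, x]]`, creates a `ψ`-term, and the next
bracket with `e₁` kills it. -/
theorem E_succ_x (F : Frame br N M V) (hL : IsLeibniz br) (hN : IsIdeal br N)
    (x : L) (i : ℕ) : br (F.E (i + 1)) x =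
      ∑ j ∈ range (M + 1), F.κ j (br (F.E 0) x) • F.E (j + i + 1)
      + (((i : ℂ) + 1) * F.κ₁ (br F.e₁ x)) • F.E (i + 1)
      + if i = 0 then F.ψ (F.π (br F.e₁ x)) else 0 := by
  induction i with
  | zero =>
    rw [← F.E_e₁ 0, hL.derivation, F.E_zero_br (hN _ F.e₁_mem x).1,
      F.br_e₁ (hN _ (F.E_mem 0) x).1]
    simp [add_assoc]
  | succ i ih =>
    rw [← F.E_e₁ (i + 1), hL.derivation, F.E_succ_br i (hN _ F.e₁_mem x).1, ih]
    have : br (if i = 0 then F.ψ (F.π (br F.e₁ x)) else 0) F.e₁ = 0 := by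
      split_ifs
      · exact F.ψ_left _ _ F.e₁_mem
      · simp
    simp only [map_add, LinearMap.add_apply, this, map_sum, LinearMap.sum_apply, map_smul,
      LinearMap.smul_apply, F.E_e₁]
    push_cast
    simp only [add_assoc, one_add_one_eq_two]
    module

theorem E_last_x (F : Frame br N M V) (hL : IsLeibniz br) (hN : IsIdeal br N) (hM : 3 ≤ M)
    (x : L) : br (F.E M) x = (F.κ 0 (br (F.E 0) x) + M * F.κ₁ (br F.e₁ x)) • F.E M := by
  obtain ⟨m, rfl⟩ : ∃ m, M = m + 1 := ⟨M - 1, by omega⟩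
  rw [F.E_succ_x hL hN, if_neg (by omega), sum_range_succ', sum_eq_zero]
  · push_cast
    simp only [zero_add, add_zero]
    module
  · intro j _
    rw [F.E_of_lt (j + 1 + m + 1) (by omega), smul_zero]

theorem ψ_x (F : Frame br N M V) (hL : IsLeibniz br) (hN : IsIdeal br N) (hM : 3 ≤ M)
    (x : L) (v : V) : br (F.ψ v) x
      = F.ψ (F.κ 0 (br (F.E 0) x) • v + F.π (br (F.φ v) x)) := by
  rw [← F.E_zero_φ, hL.derivation, F.br_φ (hN _ (F.E_mem 0) x).1,
    F.E_zero_br (hN _ (F.φ_mem v) x).1, F.κ₁_φ_x hL hN hM]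
  simp

/-! ### Left multiplication by `x` on `N` -/

theorem E_zero_br_x_left (F : Frame br N M V) (hL : IsLeibniz br) (hN : IsIdeal br N) (x : L)
    {z : L} (hz : z ∈ N) :
    F.κ₁ (br x z) • F.E 1 + F.ψ (F.π (br x z))
      = -(F.κ₁ (br z x) • F.E 1 + F.ψ (F.π (br z x))) := by
  rw [← F.E_zero_br (hN _ hz x).1, ← F.E_zero_br (hN _ hz x).2, hL.br_swap]

theorem κ₁_x_left (F : Frame br N M V) (hL : IsLeibniz br) (hN : IsIdeal br N) (hM : 3 ≤ M)
    (x : L) {z : L} (hz : z ∈ N) : F.κ₁ (br x z) = -F.κ₁ (br z x) := by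
  simpa [F.κ_E 1 1 (by omega)] using congrArg (F.κ 1) (F.E_zero_br_x_left hL hN x hz)

theorem π_x_left (F : Frame br N M V) (hL : IsLeibniz br) (hN : IsIdeal br N)
    (x : L) {z : L} (hz : z ∈ N) : F.π (br x z) = -F.π (br z x) := by
  simpa using congrArg F.ρ (F.E_zero_br_x_left hL hN x hz)

theorem br_x_E_zero_e₁ (F : Frame br N M V) (hL : IsLeibniz br) (hN : IsIdeal br N) (x : L) :
    br (br x (F.E 0)) F.e₁ = 0 := by
  have h := hL x F.e₁ (F.E 0)
  rw [F.e₁_left _ (F.E_mem 0), F.E_right 0 _ (hN _ F.e₁_mem x).2] at h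
  simpa using h.symm

theorem x_E_succ (F : Frame br N M V) (hL : IsLeibniz br) (hN : IsIdeal br N) (x : L) (i : ℕ) :
    br x (F.E (i + 1)) = 0 := by
  have step : ∀ i, br x (F.E (i + 1)) = br (br x (F.E i)) F.e₁ := fun i => by
    rw [← F.E_e₁ i, hL, F.E_right i _ (hN _ F.e₁_mem x).2, sub_zero]
  induction i with
  | zero => rw [step, F.br_x_E_zero_e₁ hL hN]
  | succ i ih => rw [step, ih]; simp

theorem x_E_zero' (F : Frame br N M V) (hL : IsLeibniz br) (hN : IsIdeal br N) (hM : 3 ≤ M)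
    (x : L) : br x (F.E 0) = F.κ M (br x (F.E 0)) • F.E M + F.ψ (F.ρ (br x (F.E 0))) := by
  conv_lhs => rw [F.eq_of_br_e₁_eq_zero (hN _ (F.E_mem 0) x).2 (F.br_x_E_zero_e₁ hL hN x),
    F.κ₁_x_left hL hN hM x (F.E_mem 0), F.π_x_left hL hN x (F.E_mem 0),
    F.κ₁_E_zero_x hL hN hM, F.π_E_zero_x hL hN]
  simp

theorem br_x_φ_e₁ (F : Frame br N M V) (hL : IsLeibniz br) (hN : IsIdeal br N) (x : L) (v : V) :
    br (br x (F.φ v)) F.e₁ = F.κ 0 (br x F.e₁) • F.ψ v := by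
  have h := hL x (F.φ v) F.e₁
  rw [F.φ_left v _ F.e₁_mem, F.br_φ (hN _ F.e₁_mem x).2, map_zero] at h
  exact sub_eq_zero.1 h.symm

/-- Right multiplication by `e₁` lands in the chain, so the `ψ`-vector in `br_x_φ_e₁` must vanish; a
nonzero `v` then forces its coefficient to be zero. -/
theorem κ_zero_x_e₁ (F : Frame br N M V) (hL : IsLeibniz br) (hN : IsIdeal br N)
    [Nontrivial V] (x : L) : F.κ 0 (br x F.e₁) = 0 := by
  obtain ⟨v, hv⟩ := exists_ne (0 : V)
  have h := congrArg F.ρ (F.br_x_φ_e₁ hL hN x v)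
  rw [F.ρ_br_e₁ (hN _ (F.φ_mem v) x).2] at h
  rw [map_smul, F.ρ_ψ] at h
  exact (smul_eq_zero.1 h.symm).resolve_right hv

theorem x_ψ (F : Frame br N M V) (hL : IsLeibniz br) (hN : IsIdeal br N) (hM : 3 ≤ M)
    (x : L) (v : V) : br x (F.ψ v) = 0 := by
  rw [← F.E_zero_φ, hL, F.E_right 0 _ (hN _ (F.φ_mem v) x).2, F.x_E_zero' hL hN hM]
  obtain ⟨m, rfl⟩ : ∃ m, M = m + 1 := ⟨M - 1, by omega⟩
  simp [F.ψ_left]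

theorem x_φ (F : Frame br N M V) (hL : IsLeibniz br) (hN : IsIdeal br N) (hM : 3 ≤ M)
    [Nontrivial V] (x : L) (v : V) : br x (F.φ v) = F.κ M (br x (F.φ v)) • F.E M
      - F.φ (F.π (br (F.φ v) x)) + F.ψ (F.ρ (br x (F.φ v))) := by
  conv_lhs => rw [F.eq_of_br_e₁_eq_zero (hN _ (F.φ_mem v) x).2
    (by rw [F.br_x_φ_e₁ hL hN, F.κ_zero_x_e₁ hL hN, zero_smul]),
    F.κ₁_x_left hL hN hM x (F.φ_mem v), F.π_x_left hL hN x (F.φ_mem v), F.κ₁_φ_x hL hN hM]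
  simp [sub_eq_add_neg]

/-- The square of `x`. -/
theorem x_x (F : Frame br N M V) (hL : IsLeibniz br) (hM : 3 ≤ M) (x : L)
    (hs : br x x ∈ N) :
    br x x = ∑ j ∈ range (M + 1), F.κ j (br x x) • F.E j + F.ψ (F.ρ (br x x)) := by
  have h : br (F.E 0) (br x x) = 0 := by rw [hL, sub_self]
  rw [F.E_zero_br hs] at h
  have h₁ : F.κ₁ (br x x) = 0 := by simpa [F.κ_E 1 1 (by omega)] using congrArg (F.κ 1) h
  have h₂ : F.π (br x x) = 0 := by simpa using congrArg F.ρ h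
  conv_lhs => rw [F.decomp _ hs, h₁, h₂]
  simp

end Frame

end Frame

/-! ### Constraints on `[x, E 0]`, normalisation of `x` -/

section Frame

variable {L V : Type*} [AddCommGroup L] [Module ℂ L] [AddCommGroup V] [Module ℂ V]
  {br : L →ₗ[ℂ] L →ₗ[ℂ] L} {N : Submodule ℂ L} {M : ℕ}

namespace Frame

theorem x_E_of_pos (F : Frame br N M V) (hL : IsLeibniz br) (hN : IsIdeal br N) (x : L) {i : ℕ}
    (hi : 0 < i) : br x (F.E i) = 0 := by
  obtain ⟨j, rfl⟩ := Nat.exists_eq_add_one.2 hi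
  exact F.x_E_succ hL hN x j

theorem x_E_zero_x (F : Frame br N M V) (hL : IsLeibniz br) (hN : IsIdeal br N) (hM : 3 ≤ M)
    (x : L) : br x (br (F.E 0) x) = F.κ 0 (br (F.E 0) x) • br x (F.E 0) := by
  conv_lhs => rw [F.E_zero_x hL hN hM x]
  simp [sum_range_succ', F.x_E_succ hL hN, F.x_ψ hL hN hM]

/-- With `s = ρ [x, E 0]` and `β = κ 0 [E 0, x]`, the `ψ`-part of `[[x, E 0], x] = β [x, E 0]` reads
`β s + A s = β s`, and `A` is injective. -/
theorem ρ_x_E_zero (F : Frame br N M V) (hL : IsLeibniz br) (hN : IsIdeal br N) (hM : 3 ≤ M)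
    {x : L} (hs : br x x ∈ N) {A : V ≃ₗ[ℂ] V} (hA : ∀ v, F.π (br (F.φ v) x) = A v) :
    F.ρ (br x (F.E 0)) = 0 := by
  have h := hL.derivation x (F.E 0) x
  rw [F.E_right 0 _ hs, zero_add, F.x_E_zero_x hL hN hM] at h
  nth_rw 1 [F.x_E_zero' hL hN hM] at h
  rw [map_add, LinearMap.add_apply, map_smul, LinearMap.smul_apply, F.E_last_x hL hN hM,
    F.ψ_x hL hN hM, hA] at h
  simpa using congrArg F.ρ h

theorem x_E_zero (F : Frame br N M V) (hL : IsLeibniz br) (hN : IsIdeal br N) (hM : 3 ≤ M)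
    {x : L} (hs : br x x ∈ N) {A : V ≃ₗ[ℂ] V} (hA : ∀ v, F.π (br (F.φ v) x) = A v) :
    br x (F.E 0) = F.κ M (br x (F.E 0)) • F.E M := by
  conv_lhs => rw [F.x_E_zero' hL hN hM, F.ρ_x_E_zero hL hN hM hs hA]
  simp

/-- Two evaluations of `[[x, E 0], x] = γ (β + M α) E M`: it equals `β γ E M` by the derivation
rule, and it is zero by the expansion of `[x, [x, E 0]] = 0`. -/
theorem x_x_E_zero_coeff (F : Frame br N M V) (hL : IsLeibniz br) (hN : IsIdeal br N)
    (hM : 3 ≤ M) {x : L} (hs : br x x ∈ N) {A : V ≃ₗ[ℂ] V}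
    (hA : ∀ v, F.π (br (F.φ v) x) = A v) :
    F.κ 0 (br (F.E 0) x) * F.κ M (br x (F.E 0)) = 0 ∧
      M * F.κ₁ (br F.e₁ x) * F.κ M (br x (F.E 0)) = 0 := by
  have h := hL.derivation x (F.E 0) x
  rw [F.E_right 0 _ hs, zero_add, F.x_E_zero_x hL hN hM] at h
  have h' := hL x x (F.E 0)
  rw [F.E_right 0 _ hs, zero_sub] at h'
  set β := F.κ 0 (br (F.E 0) x)
  set γ := F.κ M (br x (F.E 0))
  set α := F.κ₁ (br F.e₁ x)
  have e : br x (F.E 0) = γ • F.E M := F.x_E_zero hL hN hM hs hA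
  have e' : br x (F.E M) = 0 := F.x_E_of_pos hL hN x (by omega)
  rw [e, map_smul, e', map_smul, LinearMap.smul_apply, F.E_last_x hL hN hM] at h'
  rw [e, map_smul, LinearMap.smul_apply, F.E_last_x hL hN hM] at h
  have k := congrArg (F.κ M) h
  have k' := congrArg (F.κ M) h'
  simp only [map_smul, map_neg, map_zero, F.κ_E M M le_rfl, if_true, smul_eq_mul, mul_one,
    smul_zero] at k k'
  change γ * (β + M * α) = β * γ at k
  change 0 = -(γ * (β + M * α)) at k'
  have k₁ : γ * (β + M * α) = 0 := by linear_combination k'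
  constructor
  · linear_combination k₁ - k
  · linear_combination k

/-- Subtracting from `x` an element of `N` removes one coefficient of `[E 0, x]` and makes `[x, e₁]`
as simple as possible. -/
theorem exists_adjust (F : Frame br N M V) (hL : IsLeibniz br) (hN : IsIdeal br N) (hM : 3 ≤ M)
    [Nontrivial V] {x : L} (hs : br x x ∈ N) (A : V ≃ₗ[ℂ] V)
    (hA : ∀ v, F.π (br (F.φ v) x) = A v) :
    ∃ x', x - x' ∈ N ∧ br x' x' ∈ N ∧ (∀ v, F.π (br (F.φ v) x') = A v) ∧
      F.κ 1 (br (F.E 0) x') = 0 ∧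
      ∀ i ≤ M, F.κ i (br x' F.e₁ - br x' (F.φ (A.symm (F.π (br F.e₁ x'))))) = 0 := by
  set w := br x F.e₁ - br x (F.φ (A.symm (F.π (br F.e₁ x)))) with hw
  -- Chosen so that `[y, e₁]` has the chain coordinates of `w`. The coefficient of `E M` is
  -- immaterial since `[E M, e₁] = 0`, and `κ 0 w` vanishes already.
  set y : L := ∑ i ∈ range (M + 1), (if i < M then F.κ (i + 1) w else 0) • F.E i with hy
  -- The `e₁`-term cancels the `E 1`-coefficient of `[E 0, x]`. The two corrections do not
  -- interfere: `e₁` is left annihilating and `y` right annihilating on `N`.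
  set z : L := F.κ 1 (br (F.E 0) x) • F.e₁ + y with hz
  have yN : y ∈ N := Submodule.sum_mem _ fun i _ => N.smul_mem _ (F.E_mem i)
  have zN : z ∈ N := N.add_mem (N.smul_mem _ F.e₁_mem) yN
  have right_y : ∀ u ∈ N, br u y = 0 := fun u hu => by
    rw [hy, map_sum]
    exact sum_eq_zero fun i _ => by rw [map_smul, F.E_right i u hu, smul_zero]
  have left_e : br z F.e₁ = br y F.e₁ := by
    simp [hz, F.e₁_left]
  have left_φ : ∀ v, br z (F.φ v) = F.κ 0 y • F.ψ v := fun v => by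
    rw [F.br_φ zN, hz]; simp
  have e₁_z : br F.e₁ z = 0 := F.e₁_left _ zN
  have sub_left : ∀ u, br (x - z) u = br x u - br z u := fun u => by simp
  refine ⟨x - z, by simpa using zN, ?_, ?_, ?_, ?_⟩
  · rw [sub_left, map_sub]
    exact N.sub_mem (N.sub_mem hs (hN z zN _).2) (hN z zN _).1
  · intro v
    rw [map_sub, F.φ_left v z zN, sub_zero, hA]
  · rw [map_sub, hz, map_add (br (F.E 0)), right_y _ (F.E_mem 0), map_smul, F.E_e₁]
    simp [F.κ_E 1 1 (by omega)]
  · intro i hi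
    rw [map_sub (br F.e₁), e₁_z, sub_zero, sub_left, sub_left, left_e, left_φ]
    have : F.κ i (br y F.e₁) = F.κ i w := by
      rcases i with _ | j
      · rw [F.κ_zero_br_e₁ yN, hw, map_sub, F.κ_zero_x_e₁ hL hN, F.x_φ hL hN hM]
        simp [F.κ_E M 0 le_rfl, show M ≠ 0 by omega]
      · rw [F.κ_succ_br_e₁ yN j hi, hy, F.κ_sum _ j (by omega), if_pos (by omega)]
    have e : br x F.e₁ - br y F.e₁
        - (br x (F.φ (A.symm (F.π (br F.e₁ x)))) - F.κ 0 y • F.ψ (A.symm (F.π (br F.e₁ x))))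
        = w - br y F.e₁ + F.κ 0 y • F.ψ (A.symm (F.π (br F.e₁ x))) := by rw [hw]; abel
    rw [e, map_add, map_sub, this]
    simp

end Frame

/-- The action of `x` after the removable coefficients have been removed.  The map `φ'` is the
correction of `φ` on which left and right multiplication by `x` are opposite. -/
structure NormalForm (F : Frame br N M V) (A : V ≃ₗ[ℂ] V) (x : L) where
  φ' : V →ₗ[ℂ] L
  α : ℂ
  η : ℂ
  β : ℕ → ℂ
  γ : ℂ
  p : V
  b : V
  q : V
  θ : V
  τ : V
  φ'_eq : ∀ v, ∃ (ζ : ℂ) (t : V), φ' v = F.φ v + ζ • F.E M + F.ψ t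
  e₁_x : br F.e₁ x = α • F.e₁ + η • F.E M + φ' p + F.ψ b
  E_zero_x : br (F.E 0) x = ∑ j ∈ range (M + 1), β j • F.E j + F.ψ q
  β_one : β 1 = 0
  E_succ_x : ∀ i : ℕ, br (F.E (i + 1)) x = ∑ j ∈ range (M + 1), β j • F.E (j + i + 1)
    + (((i : ℂ) + 1) * α) • F.E (i + 1) + if i = 0 then F.ψ p else 0
  E_last_x : br (F.E M) x = (β 0 + M * α) • F.E M
  φ'_x : ∀ v, br (φ' v) x = φ' (A v)
  ψ_x : ∀ v, br (F.ψ v) x = F.ψ (β 0 • v + A v)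
  x_e₁ : br x F.e₁ = -(α • F.e₁) - φ' p + F.ψ θ
  x_E_zero : br x (F.E 0) = γ • F.E M
  x_E_succ : ∀ i, br x (F.E (i + 1)) = 0
  x_φ' : ∀ v, br x (φ' v) = -φ' (A v)
  x_ψ : ∀ v, br x (F.ψ v) = 0
  β_γ : β 0 * γ = 0
  α_γ : M * α * γ = 0
  x_x : ∃ c : ℂ, br x x = (-(α * η)) • F.E (M - 1) + c • F.E M + F.ψ τ
  θ_b : (β 0 - α) • θ + A θ = α • b

/-- Everything not yet determined comes from the Leibniz identity for `x, e₁, x`. It computes `[[x,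
x], e₁]`, and right multiplication by `e₁` has only chain components: they give `[x, x]`, while the
`ψ`-component must vanish, which is the equation for `θ`. -/
theorem Frame.exists_normalForm (F : Frame br N M V) (hL : IsLeibniz br) (hN : IsIdeal br N)
    (hM : 3 ≤ M) [Nontrivial V] {x : L} (hs : br x x ∈ N) (A : V ≃ₗ[ℂ] V)
    (hA : ∀ v, F.π (br (F.φ v) x) = A v) (hβ : F.κ 1 (br (F.E 0) x) = 0)
    (hε : ∀ i ≤ M, F.κ i (br x F.e₁ - br x (F.φ (A.symm (F.π (br F.e₁ x))))) = 0) :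
    Nonempty (NormalForm F A x) := by
  set φ' : V →ₗ[ℂ] L := -(br x ∘ₗ F.φ ∘ₗ A.symm.toLinearMap) with hφ'
  have φ'_apply : ∀ v, φ' v = -br x (F.φ (A.symm v)) := fun v => rfl
  have φ'_eq : ∀ v, φ' v = F.φ v + (-F.κ M (br x (F.φ (A.symm v)))) • F.E M
      + F.ψ (-F.ρ (br x (F.φ (A.symm v)))) := fun v => by
    conv_lhs => rw [φ'_apply, F.x_φ hL hN hM, hA, A.apply_symm_apply]
    rw [map_neg]
    module
  have φ'_mem : ∀ v, φ' v ∈ N := fun v => N.neg_mem (hN _ (F.φ_mem _) x).2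
  have κ₁_φ' : ∀ v, F.κ₁ (φ' v) = 0 := fun v => by rw [φ'_eq]; simp
  have π_φ' : ∀ v, F.π (φ' v) = v := fun v => by rw [φ'_eq]; simp
  have φ'_e₁ : ∀ v, br (φ' v) F.e₁ = 0 := fun v => by
    rw [φ'_apply, map_neg, LinearMap.neg_apply, F.br_x_φ_e₁ hL hN, F.κ_zero_x_e₁ hL hN]
    simp
  have x_E_last : br x (F.E M) = 0 := F.x_E_of_pos hL hN x (by omega)
  -- `φ' v` and `φ v` differ by multiples of `E M` and values of `ψ`, all killed by left
  -- multiplication by `x`.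
  have x_φ' : ∀ v, br x (φ' v) = -φ' (A v) := fun v => by
    rw [φ'_eq, φ'_apply, A.symm_apply_apply, map_add, map_add, map_smul, x_E_last,
      F.x_ψ hL hN hM]
    simp
  set p := F.π (br F.e₁ x) with hp
  set α := F.κ₁ (br F.e₁ x) with hα
  set β : ℕ → ℂ := fun j => F.κ j (br (F.E 0) x) with hβ'
  set d := br F.e₁ x - φ' p with hd
  set g := br x F.e₁ + φ' p with hg
  have ψ_x : ∀ v, br (F.ψ v) x = F.ψ (β 0 • v + A v) := fun v => by
    rw [F.ψ_x hL hN hM, hA]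
  have dN : d ∈ N := N.sub_mem (hN _ F.e₁_mem x).1 (φ'_mem p)
  have gN : g ∈ N := N.add_mem (hN _ F.e₁_mem x).2 (φ'_mem p)
  have d_eq : d = α • F.e₁ + F.κ M d • F.E M + F.ψ (F.ρ d) := by
    have h := F.eq_of_br_e₁_eq_zero dN (by
      rw [hd, map_sub, LinearMap.sub_apply, φ'_e₁, sub_zero,
        F.br_br_x_e₁_eq_zero hL hN x fun z hz => F.e₁_left z hz])
    have h₁ : F.κ₁ d = α := by rw [hd, map_sub, κ₁_φ', sub_zero]
    have h₂ : F.π d = 0 := by rw [hd, map_sub, π_φ', sub_self]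
    rw [h₁, h₂, map_zero, add_zero] at h
    exact h
  have g_eq : g = -(α • F.e₁) + F.ψ (F.ρ g) := by
    have h₁ : F.κ₁ g = -α := by
      rw [hg, map_add, κ₁_φ', add_zero, F.κ₁_x_left hL hN hM x F.e₁_mem]
    have h₂ : F.π g = 0 := by
      rw [hg, map_add, π_φ', F.π_x_left hL hN x F.e₁_mem, neg_add_cancel]
    have h₃ : ∀ i ≤ M, F.κ i g = 0 := fun i hi => by
      rw [hg, φ'_apply, ← sub_eq_add_neg, hε i hi]
    conv_lhs => rw [F.decomp g gN, h₁, h₂]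
    rw [sum_eq_zero fun i hi => by rw [h₃ i (by simpa [Nat.lt_succ_iff] using hi), zero_smul]]
    simp
  have e₁_x : br F.e₁ x = α • F.e₁ + F.κ M d • F.E M + φ' p + F.ψ (F.ρ d) := by
    rw [add_right_comm, ← d_eq, hd, sub_add_cancel]
  have x_e₁ : br x F.e₁ = -(α • F.e₁) - φ' p + F.ψ (F.ρ g) := by
    rw [sub_add_eq_add_sub, ← g_eq, hg, add_sub_cancel_right]
  have x_e₁_x : br x (br F.e₁ x) = α • br x F.e₁ - φ' (A p) := by
    conv_lhs => rw [e₁_x]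
    simp [x_φ', x_E_last, F.x_ψ hL hN hM, sub_eq_add_neg]
  have br_x_e₁_x : br (br x F.e₁) x
      = -(α • br F.e₁ x) - br (φ' p) x + F.ψ (β 0 • F.ρ g + A (F.ρ g)) := by
    rw [← ψ_x]
    conv_lhs => rw [x_e₁]
    simp
  have leib : br (br x x) F.e₁ = br (br x F.e₁) x - br x (br F.e₁ x) := by
    rw [hL x F.e₁ x]; abel
  have κ_φ'_x : ∀ v, F.κ 1 (br (φ' v) x) = 0 := fun v => by
    rw [φ'_eq, map_add, map_add, LinearMap.add_apply, LinearMap.add_apply, map_smul,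
      LinearMap.smul_apply, F.E_last_x hL hN hM, ψ_x, F.φ_x hL hN hM]
    simp [F.κ_E M 1 le_rfl, show M ≠ 1 by omega]
  -- This is needed before `φ'_x`: a nonzero `κ 0 [x, x]` would contribute `[[x, x], φ v] ≠ 0`
  -- there. It is read off as the `E 1`-coordinate of `[[x, x], e₁]`.
  have s_zero : F.κ 0 (br x x) = 0 := by
    have hκ : F.κ 1 (br x F.e₁) = 0 := by
      rw [x_e₁, φ'_eq]
      simp [F.κ_E M 1 le_rfl, show M ≠ 1 by omega]
    rw [← F.κ_succ_br_e₁ hs 0 (by omega), leib, br_x_e₁_x, x_e₁_x]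
    simp only [map_add, map_sub, map_neg, map_smul, hκ, κ_φ'_x, F.κ_e₁_x hL hN x (i := 1) (by omega),
      F.κ_ψ, zero_add]
    rw [φ'_eq]
    simp [F.κ_E M 1 le_rfl, show M ≠ 1 by omega]
  have φ'_x : ∀ v, br (φ' v) x = φ' (A v) := fun v => by
    have h := hL.derivation x (F.φ (A.symm v)) x
    rw [F.br_φ hs, s_zero, zero_smul, zero_add] at h
    rw [φ'_apply, map_neg, LinearMap.neg_apply, h, F.φ_x hL hN hM, hA, A.apply_symm_apply,
      map_add, map_add, map_smul, x_E_last, F.x_ψ hL hN hM, φ'_apply, A.symm_apply_apply]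
    simp
  have s_e₁ : br (br x x) F.e₁ = (-(α * F.κ M d)) • F.E M
      + F.ψ ((β 0 - α) • F.ρ g + A (F.ρ g) - α • F.ρ d) := by
    rw [leib, br_x_e₁_x, x_e₁_x, e₁_x, x_e₁, φ'_x]
    simp only [map_add, map_sub, map_smul]
    module
  refine ⟨⟨φ', α, F.κ M d, β, F.κ M (br x (F.E 0)), p, F.ρ d, F.ρ (br (F.E 0) x), F.ρ g,
    F.ρ (br x x), fun v => ⟨_, _, φ'_eq v⟩, e₁_x, F.E_zero_x hL hN hM x, hβ,
    F.E_succ_x hL hN x, F.E_last_x hL hN hM x, φ'_x, ψ_x, x_e₁, F.x_E_zero hL hN hM hs hA,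
    F.x_E_succ hL hN x, x_φ', F.x_ψ hL hN hM x, (F.x_x_E_zero_coeff hL hN hM hs hA).1,
    (F.x_x_E_zero_coeff hL hN hM hs hA).2, ⟨F.κ M (br x x), ?_⟩, ?_⟩⟩
  · obtain ⟨m, rfl⟩ : ∃ m, M = m + 1 := ⟨M - 1, by omega⟩
    -- The shift by `e₁` recovers every chain coordinate except the last, which stays free and
    -- becomes `δ₂`.
    have h : ∀ j ≤ m, F.κ j (br x x) = if j = m then -(α * F.κ (m + 1) d) else 0 := fun j hj => by
      rw [← F.κ_succ_br_e₁ hs j (by omega), s_e₁, map_add, map_smul, F.κ_E _ _ le_rfl]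
      simp [eq_comm]
    conv_lhs => rw [F.x_x hL hM x hs, sum_range_succ, sum_range_succ, h m le_rfl, if_pos rfl]
    rw [sum_eq_zero, zero_add, Nat.add_sub_cancel]
    intro j hj
    have hj := mem_range.1 hj
    rw [h j hj.le, if_neg hj.ne, zero_smul]
  · have h := congrArg F.ρ s_e₁
    rw [F.ρ_br_e₁ hs, map_add, map_smul, F.ρ_E, smul_zero, zero_add, F.ρ_ψ] at h
    exact sub_eq_zero.1 h.symm

end Frame

/-- Reindexing of a sum whose term with index `1` and whose terms beyond `K - c` vanish. -/
theorem sum_range_eq_add_sum_Icc {L : Type*} [AddCommGroup L] {M K c : ℕ} (f : ℕ → L)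
    (h₁ : f 1 = 0) (hK : K ≤ M + c) (hf : ∀ j, 2 ≤ j → K < j + c → j ≤ M → f j = 0) :
    ∑ j ∈ range (M + 1), f j = f 0 + ∑ i ∈ Icc (c + 2) K, f (i - c) := by
  have e : ∑ i ∈ Icc (c + 2) K, f (i - c)
      = ∑ j ∈ (range M).filter (fun j => 1 ≤ j ∧ j + 1 + c ≤ K), f (j + 1) := by
    refine sum_nbij' (fun i => i - c - 1) (fun j => j + 1 + c) ?_ ?_ ?_ ?_ ?_
    · intro i hi; simp only [mem_Icc, mem_filter, mem_range] at *; omega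
    · intro i hi; simp only [mem_Icc, mem_filter, mem_range] at *; omega
    · intro i hi; simp only [mem_Icc] at *; omega
    · intro i hi; simp only [mem_filter, mem_range] at *; omega
    · intro i hi
      simp only [mem_Icc] at hi
      congr 1; omega
  rw [e, sum_range_succ', add_comm, sum_filter_of_ne]
  intro j hj hne
  by_contra h
  rcases Nat.eq_zero_or_pos j with rfl | hj0
  · exact hne h₁
  · exact hne (hf _ (by omega) (by omega) (by have := mem_range.1 hj; omega))

/-! ### Jordan blocks as shifts of a cyclic vector -/

section Jordan

variable {V : Type*} [AddCommGroup V] [Module ℂ V]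

/-- An operator with `G i ↦ lam G i + G (i + 1)` shifted by a scalar has a complement spanned by
the cyclic vector `G 0`. -/
theorem exists_add_eq_smul_of_shift {A : V →ₗ[ℂ] V} {G : ℕ → V} {lam : ℂ}
    (hG : ∀ i, A (G i) = lam • G i + G (i + 1))
    (hspan : ⊤ ≤ Submodule.span ℂ (Set.range G)) (c : ℂ) (v : V) :
    ∃ (u : V) (t : ℂ), v + (c • u + A u) = t • G 0 := by
  have key : ∀ i, G i ∈ Submodule.span ℂ {G 0} ⊔ LinearMap.range (c • (LinearMap.id : V →ₗ[ℂ] V) + A) := by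
    intro i
    induction i with
    | zero => exact Submodule.mem_sup_left (Submodule.mem_span_singleton_self _)
    | succ i ih =>
      -- Modulo the range of `c + A`, each `G (i + 1)` is a multiple of `G i`, hence of `G 0`.
      have e : G (i + 1) = (c • (LinearMap.id : V →ₗ[ℂ] V) + A) (G i) - (c + lam) • G i := by
        simp only [LinearMap.add_apply, LinearMap.smul_apply, LinearMap.id_apply, hG]
        module
      rw [e]
      exact Submodule.sub_mem _ (Submodule.mem_sup_right ⟨_, rfl⟩) (Submodule.smul_mem _ _ ih)
  have hv : v ∈ Submodule.span ℂ {G 0} ⊔ LinearMap.range (c • (LinearMap.id : V →ₗ[ℂ] V) + A) :=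
    (hspan.trans (Submodule.span_le.2 (Set.range_subset_iff.2 key))) Submodule.mem_top
  obtain ⟨a, ha, b, ⟨u, rfl⟩, rfl⟩ := Submodule.mem_sup.1 hv
  obtain ⟨t, rfl⟩ := Submodule.mem_span_singleton.1 ha
  refine ⟨-u, t, ?_⟩
  simp only [LinearMap.add_apply, LinearMap.smul_apply, LinearMap.id_apply, map_neg]
  module

/-- Descending induction from `G k = 0`, solving `A (G i) = lam G i + G (i + 1)` for `G i`. -/
theorem surjective_of_shift {A : V →ₗ[ℂ] V} {G : ℕ → V} {lam : ℂ} (hlam : lam ≠ 0) {k : ℕ}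
    (hG : ∀ i, A (G i) = lam • G i + G (i + 1)) (hGk : ∀ i, k ≤ i → G i = 0)
    (hspan : ⊤ ≤ Submodule.span ℂ (Set.range G)) : Function.Surjective A := by
  have key : ∀ d i, k ≤ i + d → G i ∈ LinearMap.range A := by
    intro d
    induction d with
    | zero => intro i hi; rw [hGk i hi]; exact Submodule.zero_mem _
    | succ d ih =>
      intro i hi
      have e : G i = lam⁻¹ • (A (G i) - G (i + 1)) := by
        rw [hG, add_sub_cancel_right, inv_smul_smul₀ hlam]
      rw [e]
      exact Submodule.smul_mem _ _ (Submodule.sub_mem _ ⟨_, rfl⟩ (ih _ (by omega)))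
  rw [← LinearMap.range_eq_top, eq_top_iff]
  exact hspan.trans (Submodule.span_le.2 (Set.range_subset_iff.2 fun i => key k i (by omega)))

/-- The coordinates of a solution of `c θ + A θ = t G 0` for a Jordan block `A` of eigenvalue `1`. -/
theorem coord_of_shift {k : ℕ} (g : Module.Basis (Fin k) ℂ V) {A : V →ₗ[ℂ] V} {G : ℕ → V}
    (hg : ∀ i : Fin k, G i = g i) (hG : ∀ i, A (G i) = G i + G (i + 1))
    (hGk : ∀ i, k ≤ i → G i = 0) {c t : ℂ} {θ : V} (hθ : c • θ + A θ = t • G 0) :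
    ∃ y : ℕ → ℂ, θ = ∑ i ∈ range k, y i • G i ∧ (∀ i, i + 1 < k → (c + 1) * y (i + 1) + y i = 0) ∧
      (0 < k → (c + 1) * y 0 = t) := by
  set y : ℕ → ℂ := fun i => if h : i < k then g.repr θ ⟨i, h⟩ else 0 with hy
  have hsum : θ = ∑ i ∈ range k, y i • G i := by
    rw [← Fin.sum_univ_eq_sum_range (fun i => y i • G i)]
    conv_lhs => rw [← g.sum_repr θ]
    exact sum_congr rfl fun i _ => by simp [hy, hg]
  have indep : ∀ f : ℕ → ℂ, ∑ i ∈ range k, f i • G i = 0 → ∀ i < k, f i = 0 := by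
    intro f hf i hi
    rw [← Fin.sum_univ_eq_sum_range (fun i => f i • G i)] at hf
    simp only [hg] at hf
    exact Fintype.linearIndependent_iff.1 g.linearIndependent (fun i => f i) hf ⟨i, hi⟩
  have hA : A θ = θ + ∑ i ∈ range k, (if i = 0 then 0 else y (i - 1)) • G i := by
    -- The top term of the shifted sum drops out because `G k = 0`.
    have h2 : ∑ i ∈ range k, y i • G (i + 1)
        = ∑ i ∈ range k, (if i = 0 then 0 else y (i - 1)) • G i := by
      have := sum_range_succ (fun i => (if i = 0 then (0 : ℂ) else y (i - 1)) • G i) k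
      rw [hGk k le_rfl, smul_zero, add_zero, sum_range_succ'] at this
      simpa using this
    conv_lhs => rw [hsum]
    simp only [map_sum, map_smul, hG, smul_add, sum_add_distrib]
    rw [← hsum, h2]
  have h0 := indep (fun i => (c + 1) * y i + (if i = 0 then 0 else y (i - 1))
      - if i = 0 then t else 0) (by
    have e : ∑ i ∈ range k, (if i = 0 then t else 0) • G i = t • G 0 := by
      rcases Nat.eq_zero_or_pos k with rfl | hk
      · simp [hGk 0 le_rfl]
      · rw [sum_eq_single 0 (fun b _ hb => by simp [hb])
          (fun h => absurd (mem_range.2 hk) h), if_pos rfl]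
    simp only [sub_smul, add_smul, mul_smul, sum_sub_distrib, sum_add_distrib, ← smul_sum,
      ← hsum, e, one_smul]
    rw [← hθ, hA]
    abel)
  refine ⟨y, hsum, fun i hi => ?_, fun hk => ?_⟩
  · simpa using h0 (i + 1) hi
  · simpa [sub_eq_zero] using h0 0 hk

end Jordan

/-! ### The corrected basis of `N` -/

section Family

variable {L V : Type*} [AddCommGroup L] [Module ℂ L] [AddCommGroup V] [Module ℂ V]
  {br : L →ₗ[ℂ] L →ₗ[ℂ] L} {N : Submodule ℂ L} {M : ℕ}

/-- The family `e₁ + φ' u + ψ w, E 0 + ψ r, E 1 + ψ u, E 2, …, φ' (G 0), …, ψ (G 0), …`. -/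
def Frame.family (F : Frame br N M V) (φ' : V → L) (G : ℕ → V) (u w r : V) (n k : ℕ) :
    NilIdx n k → L :=
  Sum.elim
    (fun i => if (i : ℕ) = 0 then F.e₁ + φ' u + F.ψ w
      else F.E (i - 1) + F.ψ (if (i : ℕ) = 1 then r else if (i : ℕ) = 2 then u else 0))
    (fun j => if (j : ℕ) < k then φ' (G j) else F.ψ (G (j - k)))

variable (F : Frame br N M V) (φ' : V → L) (G : ℕ → V) (u w r : V) {n k : ℕ}

theorem Frame.eVec_family_one (h : 1 ≤ n - 2 * k) :
    eVec (F.family φ' G u w r n k) 1 = F.e₁ + φ' u + F.ψ w := by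
  simp [eVec, h, Frame.family]

theorem Frame.eVec_family {i : ℕ} (h₂ : 2 ≤ i) (h : i ≤ n - 2 * k) :
    eVec (F.family φ' G u w r n k) i
      = F.E (i - 2) + F.ψ (if i = 2 then r else if i = 3 then u else 0) := by
  rw [eVec, dif_pos ⟨by omega, h⟩, Frame.family, Sum.elim_inl]
  simp only
  rw [if_neg (by omega), show i - 1 - 1 = i - 2 by omega,
    if_congr (show i - 1 = 1 ↔ i = 2 by omega) rfl rfl,
    if_congr (show i - 1 = 2 ↔ i = 3 by omega) rfl rfl]

theorem Frame.fVec_family_le {i : ℕ} (h₁ : 1 ≤ i) (h : i ≤ k) :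
    fVec (F.family φ' G u w r n k) i = φ' (G (i - 1)) := by
  rw [fVec, dif_pos ⟨by omega, by omega⟩, Frame.family, Sum.elim_inr]
  exact if_pos (by simp only; omega)

theorem Frame.fVec_family_add {i : ℕ} (h₁ : 1 ≤ i) (h : i ≤ k) :
    fVec (F.family φ' G u w r n k) (k + i) = F.ψ (G (i - 1)) := by
  rw [fVec, dif_pos ⟨by omega, by omega⟩, Frame.family, Sum.elim_inr]
  simp only
  rw [if_neg (by omega), show k + i - 1 - k = i - 1 by omega]

end Family

/-! ### The multiplication table in the corrected basis -/

section Table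

variable {L V : Type*} [AddCommGroup L] [Module ℂ L] [AddCommGroup V] [Module ℂ V]
  {br : L →ₗ[ℂ] L →ₗ[ℂ] L} {N : Submodule ℂ L} {M : ℕ} {F : Frame br N M V} {A : V ≃ₗ[ℂ] V} {x : L}

namespace NormalForm

theorem φ'_mem (W : NormalForm F A x) (v : V) : W.φ' v ∈ N := by
  obtain ⟨ζ, t, h⟩ := W.φ'_eq v
  rw [h]
  exact N.add_mem (N.add_mem (F.φ_mem v) (N.smul_mem _ (F.E_mem M))) (F.ψ_mem t)

theorem φ'_left (W : NormalForm F A x) (hM : 3 ≤ M) (v : V) {y : L} (hy : y ∈ N) :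
    br (W.φ' v) y = 0 := by
  obtain ⟨ζ, t, h⟩ := W.φ'_eq v
  obtain ⟨m, rfl⟩ : ∃ m, M = m + 1 := ⟨M - 1, by omega⟩
  simp [h, F.φ_left v y hy, F.ψ_left t y hy, F.E_succ_br m hy, F.E_of_lt (m + 2) (by omega)]

theorem E_zero_φ' (W : NormalForm F A x) (v : V) : br (F.E 0) (W.φ' v) = F.ψ v := by
  obtain ⟨ζ, t, h⟩ := W.φ'_eq v
  simp [h, F.E_right M _ (F.E_mem 0), F.ψ_right t _ (F.E_mem 0)]

theorem E_succ_φ' (W : NormalForm F A x) (i : ℕ) (v : V) : br (F.E (i + 1)) (W.φ' v) = 0 := by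
  obtain ⟨ζ, t, h⟩ := W.φ'_eq v
  simp [h, F.E_right M _ (F.E_mem (i + 1)), F.ψ_right t _ (F.E_mem (i + 1))]

/-- The parameters of the table attached to a normal form and the remaining choices. -/
def params (W : NormalForm F A x) (n k : ℕ) (b₁ b₂ δ₂ δ₃ : ℂ) (y : ℕ → ℂ) : Params where
  -- Since `e_i` comes from `E (i - 2)`, `a_i` is `β (i - 2)` in the middle range; `a_3` would be
  -- the removed `β 1`. The index `n - 2k` is free for `η`, as `β M` is the separate parameter `β`.
  a i := if i = 1 then W.α else if i = 2 then W.β 0 - W.α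
    else if i = n - 2 * k then W.η else W.β (i - 2)
  b₁ := b₁
  b₂ := b₂
  β := W.β M
  γ := W.γ
  δ₁ := -(W.α * W.η)
  δ₂ := δ₂
  δ₃ := δ₃
  θ j := y (j - (n - k + 1))

variable (W : NormalForm F A x) {n k : ℕ} {b₁ b₂ δ₂ δ₃ : ℂ} {y : ℕ → ℂ}

theorem params_a_of_lt {i : ℕ} (h₃ : 3 ≤ i) (h : i < n - 2 * k) :
    (W.params n k b₁ b₂ δ₂ δ₃ y).a i = W.β (i - 2) := by
  simp only [params]
  rw [if_neg (by omega), if_neg (by omega), if_neg (by omega)]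

theorem params_relations (hM : 3 ≤ M) (hk : 1 ≤ k) (hn : 2 * k + 1 + 4 ≤ n)
    (hnk : n - 2 * k = M + 2)
    (hy : ∀ i, i + 1 < k → (W.β 0 - W.α + 1) * y (i + 1) + y i = 0)
    (hy₀ : (W.β 0 - W.α + 1) * y 0 = W.α * b₂) :
    (W.params n k b₁ b₂ δ₂ δ₃ y).Relations n k := by
  have a1 : (W.params n k b₁ b₂ δ₂ δ₃ y).a 1 = W.α := rfl
  have a2 : (W.params n k b₁ b₂ δ₂ δ₃ y).a 2 = W.β 0 - W.α := rfl
  have am : (W.params n k b₁ b₂ δ₂ δ₃ y).a (n - 2 * k) = W.η := by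
    simp only [params]
    rw [if_neg (by omega), if_neg (by omega), if_pos trivial]
  have hθn : (W.params n k b₁ b₂ δ₂ δ₃ y).θ n = y (k - 1) := by
    simp only [params]; congr 1; omega
  -- The recursion is solved downwards from the last coordinate, since `a_2 + 1` may be zero.
  have hθ : ∀ i ≤ k - 1, y (k - 1 - i) = (-1) ^ i * (W.β 0 - W.α + 1) ^ i * y (k - 1) := by
    intro i
    induction i with
    | zero => intro _; simp
    | succ i ih =>
      intro hi
      have h := hy (k - 1 - (i + 1)) (by omega)
      rw [show k - 1 - (i + 1) + 1 = k - 1 - i by omega, ih (by omega)] at h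
      linear_combination h
  have hMn : (n : ℂ) - 2 * k - 2 = M := by
    have : (n : ℂ) = 2 * k + M + 2 := by exact_mod_cast (by omega : n = 2 * k + M + 2)
    rw [this]; ring
  refine ⟨?_, ?_, ?_, ?_, ?_⟩
  · rw [a1, a2]
    simpa [params] using W.β_γ
  · rw [a1, hMn]
    exact W.α_γ
  · rw [a1, am]; rfl
  · rw [a1, a2, hθn]
    have h := hθ (k - 1) le_rfl
    rw [Nat.sub_self] at h
    obtain ⟨l, rfl⟩ : ∃ l, k = l + 1 := ⟨k - 1, by omega⟩
    rw [Nat.add_sub_cancel] at h ⊢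
    rw [h] at hy₀
    change W.α * b₂ = _
    rw [← hy₀]; ring
  · intro i hi
    rw [a2, hθn, ← hθ i hi]
    simp only [params]; congr 1; omega

/-- The hypotheses are the equations that the corrections must solve: `u` and `w` clean the `φ'`-
and `ψ`-parts of `[e_1, x]`, `r` removes the `ψ`-part of `[e_2, x]`, and `t` cleans that of `[x,
x]`. The term `ψ u` in `e_3` is forced by `e_3 = [e_2, e_1]`, and `w` changes `θ` into `θ + α w`. -/
theorem isRMu3Table {G : ℕ → V} {u w r t : V} (hM : 3 ≤ M) (hk : 1 ≤ k)
    (hn : 2 * k + 1 + 4 ≤ n) (hnk : n - 2 * k = M + 2)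
    (hG : ∀ i, A (G i) = G i + G (i + 1)) (hGk : ∀ i, k ≤ i → G i = 0)
    (hu : W.p + ((-W.α) • u + A u) = b₁ • G 0)
    (hw : W.b + ((W.β 0 - W.α) • w + A w) = b₂ • G 0)
    (hr : A r = -W.q) (ht : W.τ + (W.β 0 • t + A t) = δ₃ • G 0)
    (hy : W.θ + W.α • w = ∑ i ∈ range k, y i • G i)
    (hs : br x x = (-(W.α * W.η)) • F.E (M - 1) + δ₂ • F.E M + F.ψ W.τ) :
    IsRMu3Table br (F.family W.φ' G u w r n k) (x + F.ψ t) (W.params n k b₁ b₂ δ₂ δ₃ y) := by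
  have rX : ∀ z ∈ N, br z (x + F.ψ t) = br z x := fun z hz => by
    rw [map_add, F.ψ_right t z hz, add_zero]
  have lX : ∀ z ∈ N, br (x + F.ψ t) z = br x z := fun z hz => by
    rw [map_add, LinearMap.add_apply, F.ψ_left t z hz, add_zero]
  have br_add : ∀ a b c, br (a + b) c = br a c + br b c := fun a b c => by simp
  have e1 := F.eVec_family_one W.φ' G u w r (n := n) (k := k) (by omega)
  have e2 := F.eVec_family W.φ' G u w r (n := n) (k := k) (i := 2) le_rfl (by omega)
  have e3 := F.eVec_family W.φ' G u w r (n := n) (k := k) (i := 3) (by omega) (by omega)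
  have ei : ∀ i, 4 ≤ i → i ≤ n - 2 * k → eVec (F.family W.φ' G u w r n k) i = F.E (i - 2) :=
    fun i h4 h => by
      rw [F.eVec_family W.φ' G u w r (by omega) h, if_neg (by omega), if_neg (by omega)]; simp
  have em := ei (n - 2 * k) (by omega) le_rfl
  rw [show n - 2 * k - 2 = M by omega] at em
  have fi : ∀ i, 1 ≤ i → i ≤ k → fVec (F.family W.φ' G u w r n k) i = W.φ' (G (i - 1)) :=
    fun i h₁ h => F.fVec_family_le W.φ' G u w r h₁ h
  have fki : ∀ i, 1 ≤ i → i ≤ k → fVec (F.family W.φ' G u w r n k) (k + i) = F.ψ (G (i - 1)) :=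
    fun i h₁ h => F.fVec_family_add W.φ' G u w r h₁ h
  have f1 := fi 1 le_rfl hk
  have fk1 := fki 1 le_rfl hk
  rw [Nat.sub_self] at f1 fk1
  have e1N : F.e₁ + W.φ' u + F.ψ w ∈ N :=
    N.add_mem (N.add_mem F.e₁_mem (W.φ'_mem u)) (F.ψ_mem w)
  have eN : ∀ i, 1 ≤ i → i ≤ n - 2 * k → eVec (F.family W.φ' G u w r n k) i ∈ N := by
    intro i h₁ h
    rcases h₁.eq_or_lt with rfl | h₂
    · rw [e1]; exact e1N
    · rw [F.eVec_family W.φ' G u w r h₂ h]; exact N.add_mem (F.E_mem _) (F.ψ_mem _)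
  have f_cases : ∀ j, 1 ≤ j → j ≤ 2 * k → (j ≤ k ∧ fVec (F.family W.φ' G u w r n k) j
      = W.φ' (G (j - 1))) ∨ (k < j ∧ fVec (F.family W.φ' G u w r n k) j = F.ψ (G (j - k - 1))) := by
    intro j h₁ h
    rcases le_or_gt j k with hj | hj
    · exact Or.inl ⟨hj, fi j h₁ hj⟩
    · refine Or.inr ⟨hj, ?_⟩
      have := fki (j - k) (by omega) (by omega)
      rwa [show k + (j - k) = j by omega] at this
  have fN : ∀ i, 1 ≤ i → i ≤ 2 * k → fVec (F.family W.φ' G u w r n k) i ∈ N := by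
    intro i h₁ h
    rcases f_cases i h₁ h with ⟨_, h⟩ | ⟨_, h⟩ <;> rw [h]
    exacts [W.φ'_mem _, F.ψ_mem _]
  have f_left : ∀ i, 1 ≤ i → i ≤ 2 * k → ∀ z ∈ N,
      br (fVec (F.family W.φ' G u w r n k) i) z = 0 := by
    intro i h₁ h z hz
    rcases f_cases i h₁ h with ⟨_, h⟩ | ⟨_, h⟩ <;> rw [h]
    exacts [W.φ'_left hM _ hz, F.ψ_left _ z hz]
  have e1_left : ∀ z ∈ N, br (F.e₁ + W.φ' u + F.ψ w) z = 0 := fun z hz => by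
    simp [F.e₁_left z hz, W.φ'_left hM u hz, F.ψ_left w z hz]
  have E_e1 : ∀ i, br (F.E i) (F.e₁ + W.φ' u + F.ψ w)
      = F.E (i + 1) + F.ψ (if i = 0 then u else 0) := fun i => by
    rw [map_add, map_add, F.E_e₁, F.ψ_right w _ (F.E_mem i)]
    rcases i with _ | i
    · simp [W.E_zero_φ']
    · simp [W.E_succ_φ']
  have x_E : ∀ i, 0 < i → br x (F.E i) = 0 := fun i hi => by
    obtain ⟨j, rfl⟩ := Nat.exists_eq_add_one.2 hi
    exact W.x_E_succ j
  have hG' : A (G (k - 1)) = G (k - 1) := by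
    rw [hG, show k - 1 + 1 = k by omega, hGk k le_rfl, add_zero]
  have a1 : (W.params n k b₁ b₂ δ₂ δ₃ y).a 1 = W.α := rfl
  have a2 : (W.params n k b₁ b₂ δ₂ δ₃ y).a 2 = W.β 0 - W.α := rfl
  have a12 : (W.params n k b₁ b₂ δ₂ δ₃ y).a 1 + (W.params n k b₁ b₂ δ₂ δ₃ y).a 2 = W.β 0 := by
    rw [a1, a2]; ring
  have am : (W.params n k b₁ b₂ δ₂ δ₃ y).a (n - 2 * k) = W.η := by
    simp only [params]
    rw [if_neg (by omega), if_neg (by omega), if_pos trivial]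
  constructor
  case ei_e1 =>
    intro i h₂ h
    rw [e1, F.eVec_family W.φ' G u w r h₂ (by omega),
      F.eVec_family W.φ' G u w r (i := i + 1) (by omega) (by omega), br_add,
      E_e1, F.ψ_left _ _ e1N, add_zero, show i + 1 - 2 = i - 2 + 1 by omega,
      if_neg (show i + 1 ≠ 2 by omega), if_congr (show i + 1 = 3 ↔ i - 2 = 0 by omega) rfl rfl]
  case e2_fi =>
    intro i h₁ h
    rw [e2, fi i h₁ h, fki i h₁ h, br_add, F.ψ_left _ _ (W.φ'_mem _),
      Nat.sub_self, W.E_zero_φ', add_zero]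
  case e1_x =>
    rw [e1, rX _ e1N, em, f1, fk1, a1, am, br_add, br_add, W.e₁_x, W.φ'_x, W.ψ_x]
    change _ = _ + _ + b₁ • W.φ' (G 0) + b₂ • F.ψ (G 0)
    rw [← map_smul, ← map_smul, ← hu, ← hw]
    simp only [map_add, map_smul]
    module
  case e2_x =>
    -- The last term is split off, as its coefficient is the parameter `β` and not an `a i`.
    obtain ⟨m, hm⟩ : ∃ m, M = m + 1 := ⟨M - 1, by omega⟩
    have hsum := sum_range_eq_add_sum_Icc (M := m) (K := n - 2 * k - 1) (c := 2)
      (fun j => W.β j • F.E j) (by simp [W.β_one]) (by omega) (by omega)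
    rw [← hm] at hsum
    have hsum' : ∑ i ∈ Icc (2 + 2) (n - 2 * k - 1), W.β (i - 2) • F.E (i - 2)
        = ∑ i ∈ Icc 4 (n - 2 * k - 1), (W.params n k b₁ b₂ δ₂ δ₃ y).a i
          • eVec (F.family W.φ' G u w r n k) i := by
      refine sum_congr rfl fun i hi => ?_
      have := mem_Icc.1 hi
      rw [W.params_a_of_lt (by omega) (by omega), ei i (by omega) (by omega)]
    rw [rX _ (eN 2 (by omega) (by omega)), em, ← hsum', a12, e2, if_pos rfl, br_add,
      W.E_zero_x, W.ψ_x, hr, Nat.sub_self]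
    change _ = _ + W.β M • F.E M
    rw [sum_range_succ, hsum]
    simp only [map_add, map_smul, map_neg]
    module
  case e3_x =>
    have hsum := sum_range_eq_add_sum_Icc (M := M) (K := n - 2 * k) (c := 3)
      (fun j => W.β j • F.E (j + 0 + 1)) (by simp [W.β_one]) (by omega)
      (fun j _ _ _ => by rw [F.E_of_lt _ (by omega), smul_zero])
    have hsum' : ∑ i ∈ Icc (3 + 2) (n - 2 * k), W.β (i - 3) • F.E (i - 3 + 0 + 1)
        = ∑ i ∈ Icc 5 (n - 2 * k), (W.params n k b₁ b₂ δ₂ δ₃ y).a (i - 1)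
          • eVec (F.family W.φ' G u w r n k) i := by
      refine sum_congr rfl fun i hi => ?_
      have := mem_Icc.1 hi
      rw [W.params_a_of_lt (by omega) (by omega), ei i (by omega) (by omega),
        show i - 1 - 2 = i - 3 by omega, show i - 3 + 0 + 1 = i - 2 by omega]
    rw [rX _ (eN 3 (by omega) (by omega)), fk1, ← hsum', e3, a1, a2, if_neg (by omega), if_pos rfl,
      br_add, show 3 - 2 = 0 + 1 by rfl, W.E_succ_x, W.ψ_x, hsum, if_pos rfl]
    change _ = _ + b₁ • F.ψ (G 0)
    rw [← map_smul, ← hu]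
    simp only [map_add, map_smul, Nat.cast_zero]
    module
  case ei_x =>
    intro i h4 h
    obtain ⟨l, rfl⟩ : ∃ l, i = l + 3 := ⟨i - 3, by omega⟩
    have hsum := sum_range_eq_add_sum_Icc (M := M) (K := n - 2 * k) (c := l + 3)
      (fun j => W.β j • F.E (j + l + 1)) (by simp [W.β_one]) (by omega)
      (fun j _ _ _ => by rw [F.E_of_lt _ (by omega), smul_zero])
    have hsum' : ∑ i ∈ Icc (l + 3 + 2) (n - 2 * k), W.β (i - (l + 3)) • F.E (i - (l + 3) + l + 1)
        = ∑ j ∈ Icc (l + 3 + 2) (n - 2 * k), (W.params n k b₁ b₂ δ₂ δ₃ y).a (j - (l + 3) + 2)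
          • eVec (F.family W.φ' G u w r n k) j := by
      refine sum_congr rfl fun i hi => ?_
      have := mem_Icc.1 hi
      rw [W.params_a_of_lt (by omega) (by omega), ei i (by omega) (by omega),
        show i - (l + 3) + 2 - 2 = i - (l + 3) by omega,
        show i - (l + 3) + l + 1 = i - 2 by omega]
    rw [rX _ (eN _ (by omega) h), ← hsum', ei _ h4 h, show l + 3 - 2 = l + 1 by omega, W.E_succ_x,
      hsum, if_neg (by omega), a1, a2]
    push_cast
    simp only [zero_add]
    module
  case fi_x =>
    intro i h₁ h
    rw [rX _ (fN i h₁ (by omega)), fi i h₁ (by omega), fi (i + 1) (by omega) (by omega), W.φ'_x,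
      hG, map_add, show i + 1 - 1 = i - 1 + 1 by omega]
  case x_fi =>
    intro i h₁ h
    rw [lX _ (fN i h₁ (by omega)), fi i h₁ (by omega), fi (i + 1) (by omega) (by omega), W.x_φ',
      hG, map_add, show i + 1 - 1 = i - 1 + 1 by omega]
  case fk_x => rw [rX _ (fN k hk (by omega)), fi k hk le_rfl, W.φ'_x, hG']
  case x_fk => rw [lX _ (fN k hk (by omega)), fi k hk le_rfl, W.x_φ', hG']
  case fki_x =>
    intro i h₁ h
    rw [rX _ (fN _ (by omega) (by omega)), add_assoc k i 1, fki i h₁ (by omega),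
      fki (i + 1) (by omega) (by omega), W.ψ_x, hG, a12, show i + 1 - 1 = i - 1 + 1 by omega]
    simp only [map_add, map_smul]
    module
  case f2k_x =>
    rw [rX _ (fN _ (by omega) le_rfl), two_mul, fki k hk le_rfl, W.ψ_x, hG', a12]
    simp only [map_add, map_smul]
    module
  case x_e1 =>
    have hsum : ∑ i ∈ Icc 1 k, (W.params n k b₁ b₂ δ₂ δ₃ y).θ (n - k + i)
        • fVec (F.family W.φ' G u w r n k) (k + i) = F.ψ (W.θ + W.α • w) := by
      rw [hy, map_sum]
      refine sum_nbij' (fun i => i - 1) (fun i => i + 1) ?_ ?_ ?_ ?_ ?_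
      · intro i hi; simp only [mem_Icc, mem_range] at *; omega
      · intro i hi; simp only [mem_Icc, mem_range] at *; omega
      · intro i hi; simp only [mem_Icc] at *; omega
      · intro i _; rfl
      · intro i hi
        have hi := mem_Icc.1 hi
        rw [fki i hi.1 hi.2, map_smul]
        simp only [params]
        rw [show n - k + i - (n - k + 1) = i - 1 by omega]
    rw [hsum, e1, lX _ e1N, f1, a1, map_add, map_add, W.x_e₁, W.x_φ', W.x_ψ]
    change _ = _ - b₁ • W.φ' (G 0) + _
    rw [← map_smul, ← hu]
    simp only [map_add, map_smul]
    module
  case x_e2 =>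
    rw [lX _ (eN 2 (by omega) (by omega)), e2, em, map_add, W.x_ψ, add_zero, Nat.sub_self,
      W.x_E_zero]
    rfl
  case x_x =>
    rw [em, fk1, ei (n - 2 * k - 1) (by omega) (by omega), show n - 2 * k - 1 - 2 = M - 1 by omega,
      map_add, br_add, br_add, hs, W.x_ψ, F.ψ_left t _ (F.ψ_mem t), W.ψ_x]
    change _ = (-(W.α * W.η)) • _ + δ₂ • _ + δ₃ • F.ψ (G 0)
    rw [← map_smul, ← ht]
    simp only [map_add, map_smul]
    module
  case e1_e1 => rw [e1, e1_left _ e1N]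
  case elast_e1 => rw [em, e1, E_e1, F.E_of_lt _ (by omega), if_neg (by omega)]; simp
  case ei_ej =>
    intro i j hi hi' hj hj'
    rw [F.eVec_family W.φ' G u w r hj hj', map_add, F.E_right _ _ (eN i hi hi'),
      F.ψ_right _ _ (eN i hi hi'), add_zero]
  case ei_fj =>
    intro i j hi hi' hi₂ hj hj'
    rcases hi.eq_or_lt with rfl | h₂
    · rw [e1, e1_left _ (fN j hj hj')]
    · rw [F.eVec_family W.φ' G u w r h₂ hi', map_add, LinearMap.add_apply,
        F.ψ_left _ _ (fN j hj hj'), add_zero]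
      rcases f_cases j hj hj' with ⟨_, h⟩ | ⟨_, h⟩ <;> rw [h]
      · rw [show i - 2 = i - 3 + 1 by omega, W.E_succ_φ']
      · exact F.ψ_right _ _ (F.E_mem _)
  case e2_fkj =>
    intro j hj hj'
    rcases f_cases j (by omega) hj' with ⟨h', _⟩ | ⟨_, h⟩
    · omega
    · rw [h, F.ψ_right _ _ (eN 2 (by omega) (by omega))]
  case fi_ej => intro i j hi hi' hj hj'; exact f_left i hi hi' _ (eN j hj hj')
  case fi_fj => intro i j hi hi' hj hj'; exact f_left i hi hi' _ (fN j hj hj')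
  case x_ei =>
    intro i hi hi'
    rw [lX _ (eN i (by omega) hi'), F.eVec_family W.φ' G u w r (by omega) hi', map_add, W.x_ψ,
      add_zero, x_E _ (by omega)]
  case x_fki =>
    intro i hi hi'
    rcases f_cases i (by omega) hi' with ⟨h', _⟩ | ⟨_, h⟩
    · omega
    · rw [h, lX _ (F.ψ_mem _), W.x_ψ]

end NormalForm

end Table

/-! ### The corrected family spans `N` -/

section Span

variable {L : Type*} [AddCommGroup L] [Module ℂ L] {n k : ℕ}

theorem eVec_mem_span (v : NilIdx n k → L) (i : ℕ) :
    eVec v i ∈ Submodule.span ℂ (Set.range v) := by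
  unfold eVec
  split_ifs
  exacts [Submodule.subset_span ⟨_, rfl⟩, Submodule.zero_mem _]

theorem fVec_mem_span (v : NilIdx n k → L) (i : ℕ) :
    fVec v i ∈ Submodule.span ℂ (Set.range v) := by
  unfold fVec
  split_ifs
  exacts [Submodule.subset_span ⟨_, rfl⟩, Submodule.zero_mem _]

theorem map_mem_of_span {V : Type*} [AddCommGroup V] [Module ℂ V] {G : ℕ → V}
    (hspan : ⊤ ≤ Submodule.span ℂ (Set.range G)) {f : V →ₗ[ℂ] L} {S : Submodule ℂ L}
    (h : ∀ i, f (G i) ∈ S) (v : V) : f v ∈ S :=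
  (hspan.trans (Submodule.span_le (p := S.comap f).2 (Set.range_subset_iff.2 h)))
    (Submodule.mem_top (x := v))

variable {V : Type*} [AddCommGroup V] [Module ℂ V]
  {br : L →ₗ[ℂ] L →ₗ[ℂ] L} {N : Submodule ℂ L} {M : ℕ} {F : Frame br N M V} {A : V ≃ₗ[ℂ] V} {x : L}

/-- The change of family is triangular: `ψ` and `φ'` are recovered first, then the chain, `e₁` and
`φ`. Linear independence will follow from a dimension count. -/
theorem NormalForm.le_span_family (W : NormalForm F A x) {G : ℕ → V} (u w r : V)
    (hnk : n - 2 * k = M + 2) (hGk : ∀ i, k ≤ i → G i = 0)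
    (hspan : ⊤ ≤ Submodule.span ℂ (Set.range G)) :
    N ≤ Submodule.span ℂ (Set.range (F.family W.φ' G u w r n k)) := by
  set v := F.family W.φ' G u w r n k
  set S := Submodule.span ℂ (Set.range v)
  have hψ : ∀ y, F.ψ y ∈ S := map_mem_of_span hspan fun i => by
    rcases lt_or_ge i k with h | h
    · have := fVec_mem_span v (k + (i + 1))
      rwa [F.fVec_family_add W.φ' G u w r (by omega) (by omega)] at this
    · rw [hGk i h, map_zero]; exact S.zero_mem
  have hφ' : ∀ y, W.φ' y ∈ S := map_mem_of_span hspan fun i => by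
    rcases lt_or_ge i k with h | h
    · have := fVec_mem_span v (i + 1)
      rwa [F.fVec_family_le W.φ' G u w r (by omega) (by omega)] at this
    · rw [hGk i h, map_zero]; exact S.zero_mem
  have hE : ∀ i, F.E i ∈ S := fun i => by
    rcases le_or_gt i M with h | h
    · have := eVec_mem_span v (i + 2)
      rw [F.eVec_family W.φ' G u w r (by omega) (by omega)] at this
      exact (S.add_mem_iff_left (hψ _)).1 this
    · rw [F.E_of_lt i h]; exact S.zero_mem
  have he₁ : F.e₁ ∈ S := by
    have := eVec_mem_span v 1
    rw [F.eVec_family_one W.φ' G u w r (by omega)] at this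
    exact (S.add_mem_iff_left (hφ' _)).1 ((S.add_mem_iff_left (hψ _)).1 this)
  have hφ : ∀ y, F.φ y ∈ S := fun y => by
    obtain ⟨ζ, t, h⟩ := W.φ'_eq y
    have := hφ' y
    rw [h] at this
    exact (S.add_mem_iff_left (S.smul_mem _ (hE _))).1 ((S.add_mem_iff_left (hψ _)).1 this)
  intro y hy
  rw [F.decomp y hy]
  exact S.add_mem (S.add_mem (S.add_mem (S.smul_mem _ he₁)
    (S.sum_mem fun i _ => S.smul_mem _ (hE i))) (hφ _)) (hψ _)

end Span

/-! ### Coordinate maps of the given basis -/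

section FSpace

variable {N : Type*} [AddCommGroup N] [Module ℂ N] {n k : ℕ} (b : Module.Basis (NilIdx n k) ℂ N)

/-- The basis vectors `f_1, …, f_k` as elements of `𝓕`, numbered from `0`. -/
noncomputable def fBasis (j : ℕ) : FSpace b :=
  if h : j < k then ⟨b (fIdx n k ⟨j, h⟩), Submodule.subset_span ⟨_, rfl⟩⟩ else 0

theorem fBasis_hom_ext {X : Type*} [AddCommGroup X] [Module ℂ X] {f g : FSpace b →ₗ[ℂ] X}
    (h : ∀ j < k, f (fBasis b j) = g (fBasis b j)) : f = g := by
  ext ⟨y, hy⟩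
  induction hy using Submodule.span_induction with
  | mem y hy =>
    obtain ⟨j, rfl⟩ := hy
    simpa [fBasis, j.2] using h j j.2
  | zero => exact (map_zero f).trans (map_zero g).symm
  | add y z hy hz ihy ihz =>
    have := congrArg₂ (· + ·) ihy ihz
    simp only [← map_add] at this
    exact this
  | smul c y hy ih =>
    have := congrArg (c • ·) ih
    simp only [← map_smul] at this
    exact this

theorem projF_inl (i : Fin (n - 2 * k)) : projF b (b (Sum.inl i)) = 0 := by
  ext
  simp [projF, fIdx]

theorem projF_inr (j : Fin (2 * k)) : projF b (b (Sum.inr j)) = fBasis b j := by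
  ext
  simp only [projF, fBasis, LinearMap.codRestrict_apply, LinearMap.sum_apply,
    LinearMap.smulRight_apply, Module.Basis.coord_apply, Module.Basis.repr_self, fIdx]
  split_ifs with h
  · rw [sum_eq_single ⟨j, h⟩]
    · simp
    · intro i _ hi
      rw [Finsupp.single_apply, if_neg, zero_smul]
      intro e
      exact hi (Fin.ext (by simpa [Fin.ext_iff] using e.symm))
    · simp
  · rw [sum_eq_zero]
    · rfl
    · intro i _
      rw [Finsupp.single_apply, if_neg, zero_smul]
      intro e
      have := congrArg Fin.val (Sum.inr_injective e)
      simp at this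
      omega

/-- The map sending `f_{k+j}` to `f_j` and the other basis vectors to `0`. -/
noncomputable def unshiftF : N →ₗ[ℂ] FSpace b :=
  b.constr ℂ (Sum.elim (fun _ => 0) fun j => if k ≤ (j : ℕ) then fBasis b (j - k) else 0)

/-- The coordinate of `e_{i+1}`. -/
noncomputable def eCoord (i : ℕ) : N →ₗ[ℂ] ℂ :=
  b.constr ℂ (Sum.elim (fun j => if (j : ℕ) = i then 1 else 0) fun _ => 0)

end FSpace

/-! ### From the table of `μ₃` to an adapted presentation -/

section Table

variable {L : Type*} [AddCommGroup L] [Module ℂ L] {br : L →ₗ[ℂ] L →ₗ[ℂ] L} {N : Submodule ℂ L}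
  {n k : ℕ} {b : Module.Basis (NilIdx n k) ℂ N}

theorem eVec_succ_basis {i : ℕ} (h : i < n - 2 * k) :
    eVec (fun s => (b s : L)) (i + 1) = b (Sum.inl ⟨i, h⟩) := by
  rw [eVec, dif_pos ⟨by omega, by omega⟩]
  rfl

theorem fVec_succ_basis {i : ℕ} (h : i < 2 * k) :
    fVec (fun s => (b s : L)) (i + 1) = b (Sum.inr ⟨i, h⟩) := by
  rw [fVec, dif_pos ⟨by omega, by omega⟩]
  rfl

theorem eVec_basis_mem (i : ℕ) : eVec (fun s => (b s : L)) i ∈ N := by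
  unfold eVec
  split_ifs
  exacts [(b _).2, N.zero_mem]

theorem fVec_basis_mem (i : ℕ) : fVec (fun s => (b s : L)) i ∈ N := by
  unfold fVec
  split_ifs
  exacts [(b _).2, N.zero_mem]

theorem map_eq_zero_of_basis {X : Type*} [AddCommGroup X] [Module ℂ X] (f : L →ₗ[ℂ] X)
    (he : ∀ i, 1 ≤ i → i ≤ n - 2 * k → f (eVec (fun s => (b s : L)) i) = 0)
    (hf : ∀ i, 1 ≤ i → i ≤ 2 * k → f (fVec (fun s => (b s : L)) i) = 0) :
    ∀ y ∈ N, f y = 0 := by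
  have : f ∘ₗ N.subtype = 0 := b.ext fun s => by
    rcases s with ⟨i, h⟩ | ⟨i, h⟩
    · have := he (i + 1) (by omega) (by omega)
      rw [eVec_succ_basis h] at this
      simpa using this
    · have := hf (i + 1) (by omega) (by omega)
      rw [fVec_succ_basis h] at this
      simpa using this
  intro y hy
  exact LinearMap.congr_fun this ⟨y, hy⟩

theorem coe_fBasis {j : ℕ} (h : j < k) :
    ((fBasis b j : N) : L) = fVec (fun s => (b s : L)) (j + 1) := by
  rw [fVec_succ_basis (by omega), fBasis, dif_pos h]
  rfl

/-- Every ideal with the table of `μ₃` has an adapted presentation. -/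
theorem exists_frame (hb : IsMu3Table br (fun s => (b s : L)))
    (hn : 2 * k + 1 + 4 ≤ n) {Q : Submodule ℂ L} (hQ : IsCompl N Q) :
    ∃ F : Frame br N (n - 2 * k - 2) (FSpace b),
      (∀ v, F.φ v = ((v : N) : L)) ∧ ∀ y : N, F.π y = projF b y := by
  set e : ℕ → L := eVec (fun s => (b s : L)) with he
  set f : ℕ → L := fVec (fun s => (b s : L)) with hf
  set pr : L →ₗ[ℂ] N := N.projectionOnto Q hQ with hpr
  set φ : FSpace b →ₗ[ℂ] L := N.subtype ∘ₗ (FSpace b).subtype with hφ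
  set ψ : FSpace b →ₗ[ℂ] L := br (e 2) ∘ₗ φ with hψ
  have pr_e : ∀ i (h : i < n - 2 * k), pr (e (i + 1)) = b (Sum.inl ⟨i, h⟩) := fun i h => by
    rw [he, eVec_succ_basis h, hpr, Submodule.projectionOnto_apply_left]
  have pr_f : ∀ i (h : i < 2 * k), pr (f (i + 1)) = b (Sum.inr ⟨i, h⟩) := fun i h => by
    rw [hf, fVec_succ_basis h, hpr, Submodule.projectionOnto_apply_left]
  have e_gt : ∀ i, n - 2 * k < i → e i = 0 := fun i h => dif_neg (by omega)
  have φ_f : ∀ j < k, φ (fBasis b j) = f (j + 1) := fun j h => coe_fBasis h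
  have ψ_f : ∀ j < k, ψ (fBasis b j) = f (k + j + 1) := fun j h => by
    rw [hψ, LinearMap.comp_apply, φ_f j h, hb.e2_fj _ (by omega) (by omega), add_assoc]
  have eCoord_e : ∀ i j, j < n - 2 * k → eCoord b i (pr (e (j + 1))) = if j = i then 1 else 0 :=
    fun i j h => by rw [pr_e j h, eCoord, Module.Basis.constr_basis]; rfl
  have eCoord_f : ∀ i j, j < 2 * k → eCoord b i (pr (f (j + 1))) = 0 :=
    fun i j h => by rw [pr_f j h, eCoord, Module.Basis.constr_basis]; rfl
  have eCoord_φ : ∀ i v, eCoord b i (pr (φ v)) = 0 := fun i v =>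
    LinearMap.congr_fun (fBasis_hom_ext b (f := eCoord b i ∘ₗ pr ∘ₗ φ) (g := 0) fun j h => by
      simp only [LinearMap.comp_apply, φ_f j h, eCoord_f i j (by omega), LinearMap.zero_apply]) v
  have eCoord_ψ : ∀ i v, eCoord b i (pr (ψ v)) = 0 := fun i v =>
    LinearMap.congr_fun (fBasis_hom_ext b (f := eCoord b i ∘ₗ pr ∘ₗ ψ) (g := 0) fun j h => by
      simp only [LinearMap.comp_apply, ψ_f j h, eCoord_f i (k + j) (by omega),
        LinearMap.zero_apply]) v
  have π_e : ∀ i, projF b (pr (e (i + 1))) = 0 := fun i => by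
    rcases lt_or_ge i (n - 2 * k) with h | h
    · rw [pr_e i h, projF_inl]
    · rw [e_gt _ (by omega), map_zero, map_zero]
  have ρ_e : ∀ i, unshiftF b (pr (e (i + 1))) = 0 := fun i => by
    rcases lt_or_ge i (n - 2 * k) with h | h
    · rw [pr_e i h, unshiftF, Module.Basis.constr_basis]; rfl
    · rw [e_gt _ (by omega), map_zero, map_zero]
  have ρ_f : ∀ j < 2 * k, unshiftF b (pr (f (j + 1))) = if k ≤ j then fBasis b (j - k) else 0 :=
    fun j h => by rw [pr_f j h, unshiftF, Module.Basis.constr_basis]; rfl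
  have π_f : ∀ j < 2 * k, projF b (pr (f (j + 1))) = fBasis b j := fun j h => by
    rw [pr_f j h, projF_inr]
  have π_φ : ∀ v, projF b (pr (φ v)) = v := fun v =>
    LinearMap.congr_fun (fBasis_hom_ext b (f := projF b ∘ₗ pr ∘ₗ φ) (g := LinearMap.id)
      fun j h => by simp only [LinearMap.comp_apply, φ_f j h, π_f j (by omega),
        LinearMap.id_apply]) v
  have π_ψ : ∀ v, projF b (pr (ψ v)) = 0 := fun v =>
    LinearMap.congr_fun (fBasis_hom_ext b (f := projF b ∘ₗ pr ∘ₗ ψ) (g := 0)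
      fun j h => by
        simp only [LinearMap.comp_apply, ψ_f j h, π_f (k + j) (by omega), LinearMap.zero_apply]
        exact dif_neg (by omega)) v
  have ρ_φ : ∀ v, unshiftF b (pr (φ v)) = 0 := fun v =>
    LinearMap.congr_fun (fBasis_hom_ext b (f := unshiftF b ∘ₗ pr ∘ₗ φ) (g := 0)
      fun j h => by
        simp only [LinearMap.comp_apply, φ_f j h, ρ_f j (by omega), LinearMap.zero_apply]
        exact if_neg (by omega)) v
  have ρ_ψ : ∀ v, unshiftF b (pr (ψ v)) = v := fun v =>
    LinearMap.congr_fun (fBasis_hom_ext b (f := unshiftF b ∘ₗ pr ∘ₗ ψ) (g := LinearMap.id)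
      fun j h => by
        simp only [LinearMap.comp_apply, ψ_f j h, ρ_f (k + j) (by omega), LinearMap.id_apply]
        rw [if_pos (by omega), Nat.add_sub_cancel_left]) v
  have κ_e : ∀ i j, j < n - 2 * k → (eCoord b (i + 1) + if i = 0 then eCoord b 0 else 0)
      (pr (e (j + 1))) = if j = i + 1 ∨ (j = 0 ∧ i = 0) then 1 else 0 := fun i j h => by
    rw [LinearMap.add_apply, eCoord_e _ _ h]
    by_cases hi : i = 0
    · rw [if_pos hi, eCoord_e _ _ h]
      split_ifs <;> first | omega | simp
    · rw [if_neg hi, LinearMap.zero_apply, add_zero]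
      split_ifs <;> first | omega | rfl
  have κ_zero : ∀ i y, (∀ i, eCoord b i y = 0) →
      (eCoord b (i + 1) + if i = 0 then eCoord b 0 else 0) y = 0 := fun i y h => by
    rw [LinearMap.add_apply, h, zero_add]
    split_ifs
    exacts [h 0, rfl]
  have φ_mem : ∀ v, φ v ∈ N := fun v => (v : N).2
  have ψ_mem : ∀ v, ψ v ∈ N := fun v => by
    have : N.mkQ ∘ₗ ψ = 0 := fBasis_hom_ext b fun j h => by
      rw [LinearMap.comp_apply, ψ_f j h, LinearMap.zero_apply, Submodule.mkQ_apply,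
        Submodule.Quotient.mk_eq_zero]
      exact fVec_basis_mem _
    have := LinearMap.congr_fun this v
    rwa [LinearMap.comp_apply, LinearMap.zero_apply, Submodule.mkQ_apply,
      Submodule.Quotient.mk_eq_zero] at this
  have f_left : ∀ i, 1 ≤ i → i ≤ 2 * k → ∀ y ∈ N, br (f i) y = 0 := fun i h₁ h₂ =>
    map_eq_zero_of_basis (b := b) (br (f i)) (fun j h h' => hb.fi_ej i j h₁ h₂ h h')
      (fun j h h' => hb.fi_fj i j h₁ h₂ h h')
  have f_right : ∀ j, k + 1 ≤ j → j ≤ 2 * k → ∀ y ∈ N, br y (f j) = 0 := fun j h₁ h₂ =>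
    map_eq_zero_of_basis (b := b) (br.flip (f j))
      (fun i h h' => by
        rcases le_or_gt i 2 with hi | hi
        · exact hb.e12_fj i j h hi h₁ h₂
        · exact hb.ei_fj i j hi h' (by omega) h₂)
      (fun i h h' => hb.fi_fj i j h h' (by omega) h₂)
  refine ⟨{
    -- `e 1` and `e 2` have the same right products with all of `N`, so their difference annihilates
    -- `N` from the left.
    e₁ := e 1 - e 2
    E := fun i => e (i + 2)
    φ := φ
    ψ := ψ
    κ₁ := eCoord b 0 ∘ₗ pr
    -- Because `e 1 = e₁ + E 0`, the coordinate of `e 1` also counts towards `κ 0`.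
    κ := fun j => (eCoord b (j + 1) + if j = 0 then eCoord b 0 else 0) ∘ₗ pr
    π := projF b ∘ₗ pr
    ρ := unshiftF b ∘ₗ pr
    e₁_mem := N.sub_mem (eVec_basis_mem 1) (eVec_basis_mem 2)
    E_mem := fun i => eVec_basis_mem _
    φ_mem := φ_mem
    ψ_mem := ψ_mem
    E_of_lt := fun i h => e_gt _ (by omega)
    decomp := ?_
    κ₁_e₁ := ?_
    κ₁_E := ?_
    κ₁_φ := fun v => eCoord_φ 0 v
    κ₁_ψ := fun v => eCoord_ψ 0 v
    κ_e₁ := ?_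
    κ_E := ?_
    κ_φ := ?_
    κ_ψ := ?_
    π_e₁ := ?_
    π_E := fun i => π_e (i + 1)
    π_φ := π_φ
    π_ψ := π_ψ
    ρ_e₁ := ?_
    ρ_E := fun i => ρ_e (i + 1)
    ρ_φ := ρ_φ
    ρ_ψ := ρ_ψ
    e₁_left := ?_
    φ_left := ?_
    ψ_left := ?_
    E_right := ?_
    ψ_right := ?_
    E_e₁ := ?_
    E_zero_φ := fun v => rfl
    E_succ_φ := ?_ }, fun v => rfl, fun y => ?_⟩
  case refine_1 =>
    intro y hy
    refine sub_eq_zero.1 ?_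
    set T : L →ₗ[ℂ] L := LinearMap.id - ((eCoord b 0 ∘ₗ pr).smulRight (e 1 - e 2)
      + ∑ i ∈ range (n - 2 * k - 2 + 1),
        ((eCoord b (i + 1) + if i = 0 then eCoord b 0 else 0) ∘ₗ pr).smulRight (e (i + 2))
      + φ ∘ₗ projF b ∘ₗ pr + ψ ∘ₗ unshiftF b ∘ₗ pr) with hT
    have key : T y = 0 := map_eq_zero_of_basis (b := b) T
      (fun i h₁ h => by
        obtain ⟨j, rfl⟩ : ∃ j, i = j + 1 := ⟨i - 1, by omega⟩
        simp only [hT, LinearMap.sub_apply, LinearMap.add_apply, LinearMap.sum_apply,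
          LinearMap.smulRight_apply, LinearMap.comp_apply, LinearMap.id_apply]
        change e (j + 1) - (eCoord b 0 (pr (e (j + 1))) • (e 1 - e 2)
          + ∑ i ∈ range (n - 2 * k - 2 + 1), (eCoord b (i + 1)
            + if i = 0 then eCoord b 0 else 0) (pr (e (j + 1))) • e (i + 2)
          + φ (projF b (pr (e (j + 1)))) + ψ (unshiftF b (pr (e (j + 1))))) = 0
        -- Truncated subtraction is intended in `j - 1`: both `e 1` and `e 2` have their only chain
        -- coordinate at index `0`.
        rw [π_e, ρ_e, eCoord_e 0 j (by omega), map_zero, map_zero, add_zero, add_zero,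
          sum_eq_single (j - 1)]
        · rw [κ_e (j - 1) j (by omega), if_pos (show j = j - 1 + 1 ∨ _ by omega), one_smul]
          rcases j with _ | j
          · simp
          · simp
        · intro i _ hi
          rw [κ_e _ j (by omega), if_neg (by omega), zero_smul]
        · intro h
          rw [mem_range] at h
          omega)
      (fun i h₁ h => by
        obtain ⟨j, rfl⟩ : ∃ j, i = j + 1 := ⟨i - 1, by omega⟩
        simp only [hT, LinearMap.sub_apply, LinearMap.add_apply, LinearMap.sum_apply,
          LinearMap.smulRight_apply, LinearMap.comp_apply, LinearMap.id_apply]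
        change f (j + 1) - (eCoord b 0 (pr (f (j + 1))) • (e 1 - e 2)
          + ∑ i ∈ range (n - 2 * k - 2 + 1), (eCoord b (i + 1)
            + if i = 0 then eCoord b 0 else 0) (pr (f (j + 1))) • e (i + 2)
          + φ (projF b (pr (f (j + 1)))) + ψ (unshiftF b (pr (f (j + 1))))) = 0
        rw [sum_eq_zero fun i _ => by
          rw [κ_zero i _ fun i => eCoord_f i j (by omega), zero_smul],
          eCoord_f 0 j (by omega), π_f j (by omega), ρ_f j (by omega), zero_smul, zero_add, zero_add]
        by_cases hj : k ≤ j
        · rw [if_pos hj, ψ_f _ (by omega), show fBasis b j = 0 from dif_neg (by omega), map_zero,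
            show k + (j - k) + 1 = j + 1 by omega]
          simp
        · rw [if_neg hj, φ_f _ (by omega), map_zero]
          simp) y hy
    simpa [hT] using key
  case refine_2 =>
    change eCoord b 0 (pr (e 1 - e 2)) = 1
    rw [map_sub, map_sub, eCoord_e 0 0 (by omega), eCoord_e 0 1 (by omega)]
    simp
  case refine_3 =>
    intro i
    change eCoord b 0 (pr (e (i + 1 + 1))) = 0
    rcases lt_or_ge (i + 1) (n - 2 * k) with h | h
    · rw [eCoord_e 0 _ h, if_neg (by omega)]
    · rw [e_gt _ (by omega), map_zero, map_zero]
  case refine_4 =>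
    intro j
    change (eCoord b (j + 1) + if j = 0 then eCoord b 0 else 0) (pr (e 1 - e 2)) = 0
    rw [map_sub, map_sub, κ_e j 0 (by omega), κ_e j 1 (by omega)]
    by_cases h : j = 0
    · rw [if_pos (by omega), if_pos (by omega), sub_self]
    · rw [if_neg (by omega), if_neg (by omega), sub_self]
  case refine_5 =>
    intro i j hi
    change (eCoord b (j + 1) + if j = 0 then eCoord b 0 else 0) (pr (e (i + 1 + 1))) = _
    rw [κ_e j _ (by omega)]
    exact if_congr (by omega) rfl rfl
  case refine_6 => exact fun j v => κ_zero j _ fun i => eCoord_φ i v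
  case refine_7 => exact fun j v => κ_zero j _ fun i => eCoord_ψ i v
  case refine_8 =>
    change projF b (pr (e 1 - e 2)) = 0
    rw [map_sub, map_sub, π_e 0, π_e 1, sub_zero]
  case refine_9 =>
    change unshiftF b (pr (e 1 - e 2)) = 0
    rw [map_sub, map_sub, ρ_e 0, ρ_e 1, sub_zero]
  case refine_10 =>
    refine map_eq_zero_of_basis (b := b) (br (e 1 - e 2)) (fun i h h' => ?_) fun j h h' => ?_
    · change br (e 1 - e 2) (e i) = 0
      rw [map_sub, LinearMap.sub_apply]
      rcases h.eq_or_lt with rfl | h₂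
      · rw [hb.e1_e1, hb.ei_e1 2 le_rfl (by omega), sub_self]
      · rw [hb.ei_ej 1 i le_rfl (by omega) h₂ h', hb.ei_ej 2 i (by omega) (by omega) h₂ h',
          sub_zero]
    · change br (e 1 - e 2) (f j) = 0
      rw [map_sub, LinearMap.sub_apply]
      rcases le_or_gt j k with hj | hj
      · rw [hb.e1_fj j h hj, hb.e2_fj j h hj, sub_self]
      · rw [hb.e12_fj 1 j le_rfl (by omega) hj h', hb.e12_fj 2 j (by omega) le_rfl hj h', sub_zero]
  case refine_11 =>
    intro v y hy
    exact LinearMap.congr_fun (fBasis_hom_ext b (f := br.flip y ∘ₗ φ) (g := 0) fun j h => by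
      rw [LinearMap.comp_apply, φ_f j h]
      exact f_left _ (by omega) (by omega) y hy) v
  case refine_12 =>
    intro v y hy
    exact LinearMap.congr_fun (fBasis_hom_ext b (f := br.flip y ∘ₗ ψ) (g := 0) fun j h => by
      rw [LinearMap.comp_apply, ψ_f j h]
      exact f_left _ (by omega) (by omega) y hy) v
  case refine_13 =>
    intro i
    rcases lt_or_ge (i + 1) (n - 2 * k) with h | h
    · exact map_eq_zero_of_basis (b := b) (br.flip (e (i + 2)))
        (fun j h₁ h₂ => hb.ei_ej j (i + 2) h₁ h₂ (by omega) (by omega))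
        (fun j h₁ h₂ => hb.fi_ej j (i + 2) h₁ h₂ (by omega) (by omega))
    · intro y _
      rw [e_gt _ (by omega), map_zero]
  case refine_14 =>
    intro v y hy
    exact LinearMap.congr_fun (fBasis_hom_ext b (f := br y ∘ₗ ψ) (g := 0) fun j h => by
      rw [LinearMap.comp_apply, ψ_f j h]
      exact f_right _ (by omega) (by omega) y hy) v
  case refine_15 =>
    intro i
    change br (e (i + 2)) (e 1 - e 2) = e (i + 2 + 1)
    rcases lt_trichotomy (i + 2) (n - 2 * k) with h | h | h
    · rw [map_sub, hb.ei_e1 _ (by omega) (by omega),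
        hb.ei_ej (i + 2) 2 (by omega) h.le le_rfl (by omega), sub_zero]
    · rw [e_gt (i + 2 + 1) (by omega), map_sub, hb.ei_ej (i + 2) 2 (by omega) h.le le_rfl (by omega),
        sub_zero, h, hb.elast_e1]
    · rw [e_gt _ h, e_gt (i + 2 + 1) (by omega)]
      simp
  case refine_16 =>
    intro i v
    change br (e (i + 3)) (φ v) = 0
    rcases le_or_gt (i + 3) (n - 2 * k) with h | h
    · exact LinearMap.congr_fun (fBasis_hom_ext b (f := br (e (i + 3)) ∘ₗ φ) (g := 0)
        fun j hj => by
          rw [LinearMap.comp_apply, φ_f j hj]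
          exact hb.ei_fj _ _ (by omega) h (by omega) (by omega)) v
    · rw [e_gt _ h]
      simp
  case refine_17 =>
    change projF b (pr y) = _
    rw [hpr, Submodule.projectionOnto_apply_left]

end Table

/-! ### Reduction to eigenvalue `1`, and `[x, x] ∈ N` -/

section Reduction

variable {L : Type*} [AddCommGroup L] [Module ℂ L] {br : L →ₗ[ℂ] L →ₗ[ℂ] L} {N : Submodule ℂ L}

/-- Rescaling turns a Jordan block of eigenvalue `lam ≠ 0` into one of eigenvalue `1`. -/
theorem IsJordanBlock.exists_shift {V : Type*} [AddCommGroup V] [Module ℂ V] {k : ℕ}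
    {S : V →ₗ[ℂ] V} {lam : ℂ} (h : IsJordanBlock k S lam) (hlam : lam ≠ 0) :
    ∃ (g : Module.Basis (Fin k) ℂ V) (G : ℕ → V), (∀ i : Fin k, G i = g i) ∧
      (∀ i, k ≤ i → G i = 0) ∧ ∀ i, (lam⁻¹ • S) (G i) = G i + G (i + 1) := by
  obtain ⟨g, hg⟩ := h
  have hu : ∀ i : Fin k, IsUnit (lam⁻¹ ^ (i : ℕ)) := fun i =>
    (pow_ne_zero _ (inv_ne_zero hlam)).isUnit
  refine ⟨g.isUnitSMul hu, fun i => if h : i < k then lam⁻¹ ^ i • g ⟨i, h⟩ else 0, fun i => ?_,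
    fun i hi => dif_neg (by omega), fun i => ?_⟩
  · rw [Module.Basis.isUnitSMul_apply]
    exact dif_pos i.2
  · by_cases hi : i < k
    · simp only [dif_pos hi]
      rw [map_smul, LinearMap.smul_apply, hg]
      by_cases hi' : i + 1 < k
      · rw [dif_pos hi', dif_pos hi', smul_add, smul_add, inv_smul_smul₀ hlam, pow_succ, mul_smul]
      · rw [dif_neg hi', dif_neg hi', add_zero, add_zero, inv_smul_smul₀ hlam]
    · simp only [dif_neg hi, dif_neg (show ¬ i + 1 < k by omega), map_zero, add_zero]

/-- The square of `x` lies in `N` if `x` acts injectively on a nonzero part of `N`. -/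
theorem Frame.x_x_mem {V : Type*} [AddCommGroup V] [Module ℂ V] [Nontrivial V] {M : ℕ}
    (F : Frame br N M V) (hL : IsLeibniz br) {x : L}
    (hQ : N ⊔ Submodule.span ℂ {x} = ⊤) (A : V ≃ₗ[ℂ] V)
    (hA : ∀ v, F.π (br (F.φ v) x) = A v) : br x x ∈ N := by
  have h : br x x ∈ N ⊔ Submodule.span ℂ {x} := hQ ▸ Submodule.mem_top
  obtain ⟨y, hy, z, hz, e⟩ := Submodule.mem_sup.1 h
  obtain ⟨t, rfl⟩ := Submodule.mem_span_singleton.1 hz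
  obtain ⟨v, hv⟩ := exists_ne (0 : V)
  -- If `[x, x] = y + t x` with `y ∈ N`, the `φ`-part of this identity is `t A v = 0`.
  have h0 : br (F.φ v) (br x x) = 0 := by rw [hL, sub_self]
  rw [← e, map_add, F.φ_left v y hy, zero_add, map_smul] at h0
  have h1 := congrArg F.π h0
  rw [map_smul, hA, map_zero, smul_eq_zero, LinearEquiv.map_eq_zero_iff] at h1
  rw [← e, h1.resolve_right hv, zero_smul, add_zero]
  exact hy

end Reduction

end Leib

/-! ### Assembly of the proof -/

open Leib in
theorem mainTheorem9 {L : Type*} [AddCommGroup L] [Module ℂ L] (br : L →ₗ[ℂ] L →ₗ[ℂ] L)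
    (n k : ℕ) (hk : 1 ≤ k) (hn : 2 * k + 1 + 4 ≤ n)
    (hL : Leib.IsLeibniz br) (hsolv : Leib.IsSolvableAlg br)
    (N : Submodule ℂ L) (hN : Leib.IsNilradical br N)
    (b : Module.Basis (Leib.NilIdx n k) ℂ N)
    (hb : Leib.IsMu3Table br (fun s => (b s : L)))
    (x : L) (hx : x ≠ 0) (hQ : IsCompl N (Submodule.span ℂ {x}))
    (lam : ℂ) (hlam : lam ≠ 0)
    (hJ : Leib.IsJordanBlock k (Leib.compressF b (Leib.rightMulOn hN.isIdeal x)) lam) :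
    ∃ (B : Module.Basis (Leib.NilIdx n k ⊕ Unit) ℂ L) (P : Leib.Params),
      Leib.IsRMu3Table br (fun s => B (Sum.inl s)) (B (Sum.inr ())) P ∧
        P.Relations n k := by
  obtain ⟨F, hφ, hπ⟩ := exists_frame hb hn hQ
  obtain ⟨g, G, hgG, hGk, hG⟩ := hJ.exists_shift hlam
  have hspan : ⊤ ≤ Submodule.span ℂ (Set.range G) := by
    rw [← g.span_eq]
    exact Submodule.span_mono (Set.range_subset_iff.2 fun i => ⟨i, hgG i⟩)
  have : Module.Finite ℂ (FSpace b) := Module.Finite.of_basis g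
  have : Nontrivial (FSpace b) := ⟨g ⟨0, hk⟩, 0, g.ne_zero _⟩
  have hsurj := surjective_of_shift one_ne_zero
    (fun i => by rw [hG i, one_smul]) hGk hspan
  set A : FSpace b ≃ₗ[ℂ] FSpace b := LinearEquiv.ofBijective
    (lam⁻¹ • compressF b (rightMulOn hN.isIdeal x))
    ⟨LinearMap.injective_iff_surjective.2 hsurj, hsurj⟩
  have hAG : ∀ i, A (G i) = G i + G (i + 1) := hG
  have hM : 3 ≤ n - 2 * k - 2 := by omega
  have hnk : n - 2 * k = n - 2 * k - 2 + 2 := by omega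
  have hA : ∀ v, F.π (br (F.φ v) (lam⁻¹ • x)) = A v := fun v => by
    rw [map_smul, map_smul, hφ]
    exact congrArg (lam⁻¹ • ·) (hπ (rightMulOn hN.isIdeal x v))
  have hsx : Submodule.span ℂ {lam⁻¹ • x} = Submodule.span ℂ {x} :=
    Submodule.span_singleton_smul_eq (inv_ne_zero hlam).isUnit x
  have hs₀ := F.x_x_mem hL (by rw [hsx]; exact hQ.sup_eq_top) A hA
  obtain ⟨x', hxx', hs, hA', hβ, hε⟩ := F.exists_adjust hL hN.isIdeal hM hs₀ A hA
  obtain ⟨W⟩ := F.exists_normalForm hL hN.isIdeal hM hs A hA' hβ hε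
  have shift : ∀ (c : ℂ) (v : FSpace b), ∃ (u : FSpace b) (t : ℂ), v + (c • u + A u) = t • G 0 :=
    exists_add_eq_smul_of_shift (A := A.toLinearMap) (lam := 1)
      (fun i => by rw [one_smul]; exact hAG i) hspan
  obtain ⟨u, b₁, hu⟩ := shift (-W.α) W.p
  obtain ⟨w, b₂, hw⟩ := shift (W.β 0 - W.α) W.b
  obtain ⟨t, δ₃, ht⟩ := shift (W.β 0) W.τ
  obtain ⟨δ₂, hδ⟩ := W.x_x
  obtain ⟨r, hr⟩ := A.surjective (-W.q)
  -- The relation `W.θ_b` plus `α` times the equation for `w`: the vector `b` cancels and only `G 0`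
  -- remains.
  have hθ : (W.β 0 - W.α) • (W.θ + W.α • w) + A (W.θ + W.α • w) = (W.α * b₂) • G 0 := by
    rw [mul_smul, ← hw, map_add, map_smul, smul_add W.α W.b, ← W.θ_b]
    module
  obtain ⟨y, hy, hy₁, hy₀⟩ := coord_of_shift g (A := A.toLinearMap) hgG hAG hGk hθ
  have table := W.isRMu3Table hM hk hn hnk hAG hGk hu hw hr ht hy hδ
  have rel := W.params_relations (b₁ := b₁) (δ₂ := δ₂) (δ₃ := δ₃) hM hk hn hnk hy₁ (hy₀ hk)
  set v := F.family W.φ' G u w r n k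
  have hNv := W.le_span_family u w r hnk hGk hspan
  set T := Submodule.span ℂ (Set.range (Sum.elim v fun _ : Unit => x' + F.ψ t)) with hT
  have hvT : N ≤ T := hNv.trans (Submodule.span_mono (by
    rw [Set.Sum.elim_range]; exact Set.subset_union_left))
  have hxT : lam⁻¹ • x ∈ T := by
    have h : x' + F.ψ t ∈ T := Submodule.subset_span ⟨Sum.inr (), rfl⟩
    have h' := T.add_mem (hvT hxx') ((T.add_mem_iff_left (hvT (F.ψ_mem t))).1 h)
    rwa [sub_add_cancel] at h'
  have hTtop : ⊤ ≤ T := by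
    rw [← hQ.sup_eq_top, ← hsx]
    exact sup_le hvT ((Submodule.span_singleton_le_iff_mem _ _).2 hxT)
  have : Module.Finite ℂ N := Module.Finite.of_basis b
  have hcard : Fintype.card (NilIdx n k ⊕ Unit) = Module.finrank ℂ L := by
    rw [← (Submodule.prodEquivOfIsCompl N _ hQ).finrank_eq, Module.finrank_prod,
      finrank_span_singleton hx, Module.finrank_eq_card_basis b, Fintype.card_sum]
    rfl
  refine ⟨basisOfTopLeSpanOfCardEqFinrank _ hTtop hcard, _, ?_, rel⟩
  rw [coe_basisOfTopLeSpanOfCardEqFinrank]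
  exact table
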